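/- Let $T>0$, $I=[0,T]$, let $U\subset\mathbb{R}^m$ be compact, and let $\mathcal U=L^\infty(I;U)$. Let $\mathcal X=\mathcal M_c^+(\mathbb{R}^n)$ be the set of finite nonnegative Borel measures on $\mathbb{R}^n$ with compact support, $\mathcal Y=\mathcal P_c(\mathbb{R}^n\times\mathbb{R}^+)$ the set of Borel probability measures on $\mathbb{R}^n\times\mathbb{R}^+$ with compact support, where $\mathbb{R}^+=[0,\infty)$, and $$\|\mu-\mu'\|_K=\sup\Big\{\int\phi\,\mathrm d(\mu-\mu') : \|\phi\|_\infty\le 1,\ \mathrm{Lip}(\phi)\le 1\Big\}$$ the Kantorovich--Rubinstein distance on $\mathcal X$. Let $F\colon I\times U\times\mathcal X\times\mathbb{R}^n\to\mathbb{R}^n$ and $G\colon I\times U\times\mathcal X\times\mathbb{R}^n\to\mathbb{R}$ satisfy the following. 1. $(t,u)\mapsto F_t(u,\mu,x)$ and $(t,u)\mapsto G_t(u,\mu,x)$ are continuous on $I\times U$ for all $\mu\in\mathcal X$, $x\in\mathbb{R}^n$. 2. For every compact $E\subset\mathbb{R}^n$ there is $M_E>0$ such that $|F_t(u,\mu,x)-F_t(u,\mu',x')|$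 and $|G_t(u,\mu,x)-G_t(u,\mu',x')|$ are at most $M_E(|x-x'|+\|\mu-\mu'\|_K)$ for all $t\in I$, $u\in U$, $x,x'\in E$ and all $\mu,\mu'\in\mathcal X$ supported in $E$. 3. There is $C>0$ such that $|F_t(u,\mu,x)|\le C(1+\mu(\mathbb{R}^n))$ and $|G_t(u,\mu,x)|\le C$ for all $t\in I$, $u\in U$, $\mu\in\mathcal X$, $x\in\mathbb{R}^n$. Let $\vartheta\in\mathcal X$ be a probability measure and let $\ell\colon\mathcal X\to\mathbb{R}$. Let $\beta\colon\mathcal Y\to\mathcal X$ be the barycentric projection, $\langle\beta(\rho),\phi\rangle=\int y\,\phi(x)\,\mathrm d\rho(x,y)$, and put $\mathbf F_t(u,\rho,(x,y))=\big(F_t(u,\beta(\rho),x),\ y\,G_t(u,\beta(\rho),x)\big)$. For $u\in\mathcal U$, a solution of the nonlocal balance law $$\partial_t\mu_t+\nabla_x\cdot[F_t(u_t,\mu_t)\mu_t]=G_t(u_t,\mu_t)\mu_t,\qquad \mu_0=\vartheta, \tag{1}$$ is a map $\mu\colon I\to\mathcal X$ with $\mu_0=\vartheta$ such that, for every $\phi\in\mathcal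 C^1(\mathbb{R}^n)$, the function $t\mapsto\langle\mu_t,\phi\rangle$ is absolutely continuous on $I$ and for a.e. $t\in I$ $$\frac{\mathrm d}{\mathrm dt}\langle\mu_t,\phi\rangle=\big\langle\mu_t,\ \nabla_x\phi\cdot F_t(u_t,\mu_t)+G_t(u_t,\mu_t)\,\phi\big\rangle .$$ A solution of the nonlocal continuity equation $$\partial_t\rho_t+\nabla_{(x,y)}\cdot[\mathbf F_t(u_t,\rho_t)\rho_t]=0,\qquad \rho_0=\vartheta\otimes\delta_1, \tag{2}$$ is a map $\rho\colon I\to\mathcal Y$ with $\rho_0=\vartheta\otimes\delta_1$ such that, for every $\phi\in\mathcal C^1(\mathbb{R}^n\times\mathbb{R}^+)$, the function $t\mapsto\langle\rho_t,\phi\rangle$ is absolutely continuous on $I$ and $\frac{\mathrm d}{\mathrm dt}\langle\rho_t,\phi\rangle=\langle\rho_t,\nabla_{(x,y)}\phi\cdot\mathbf F_t(u_t,\rho_t)\rangle$ for a.e. $t\in I$. Then for every $u\in\mathcal U$ the problem (1) has a unique solution $t\mapsto\mu_t$, the problem (2) has a unique solution $t\mapsto\rho_t$, and $$\mu_t=\beta(\rho_t)\qquad\text{for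 all } t\in I.$$ Consequently the two optimal control problems $$(P)\quad \ell(\mu_T)\to\inf,\ u\in\mathcal U,\ \text{subject to (1)},\qquad\qquad (\mathbf P)\quad \ell(\beta(\rho_T))\to\inf,\ u\in\mathcal U,\ \text{subject to (2)},$$ have the same optimal controls: $u\in\mathcal U$ is optimal for $(P)$ if and only if it is optimal for $(\mathbf P)$. -/

import Mathlib

open MeasureTheory Set

namespace BalanceLaw

noncomputable section

/-- The Euclidean space `ℝⁿ`. -/
abbrev Rn (n : ℕ) : Type := EuclideanSpace ℝ (Fin n)

/-- The measure `μ` is carried by the set `S`. For compact `S` this says `spt μ ⊆ S`. -/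
def CarriedBy {X : Type*} [MeasurableSpace X] (μ : Measure X) (S : Set X) : Prop :=
  μ Sᶜ = 0

/-- `𝒳 = 𝓜_c⁺(ℝⁿ)`: finite nonnegative Borel measures on `ℝⁿ` with compact support. -/
def StateSpace (n : ℕ) : Type :=
  {μ : Measure (Rn n) // IsFiniteMeasure μ ∧ ∃ K, IsCompact K ∧ CarriedBy μ K}

/-- `𝒴 = 𝓟_c(ℝⁿ × ℝ⁺)`, `ℝ⁺ = [0, ∞)`: Borel probability measures whose support is a compact
subset of `ℝⁿ × [0, ∞)`, regarded as measures on `ℝⁿ × ℝ`. -/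
def LiftedSpace (n : ℕ) : Type :=
  {ρ : Measure (Rn n × ℝ) // IsProbabilityMeasure ρ ∧
    ∃ K, IsCompact K ∧ K ⊆ univ ×ˢ Ici (0 : ℝ) ∧ CarriedBy ρ K}

/-- The Kantorovich–Rubinstein norm `‖μ - ν‖_K` of the difference of two finite measures: the
supremum of `∫ φ d(μ - ν)` over all `φ` with `‖φ‖_∞ ≤ 1` and `Lip(φ) ≤ 1`. -/
def krDist {n : ℕ} (μ ν : StateSpace n) : ℝ :=
  sSup {r : ℝ | ∃ φ : Rn n → ℝ, LipschitzWith 1 φ ∧ (∀ x, |φ x| ≤ 1) ∧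
    r = ∫ x, φ x ∂μ.1 - ∫ x, φ x ∂ν.1}

/-- The measure `A ↦ ∫_{A × ℝ} y dρ(x, y)` (where `y ≥ 0` on the support of `ρ`). -/
def baryMeasure {n : ℕ} (ρ : Measure (Rn n × ℝ)) : Measure (Rn n) :=
  (ρ.withDensity fun z => ENNReal.ofReal z.2).map Prod.fst

theorem baryMeasure_mem {n : ℕ} (ρ : LiftedSpace n) :
    IsFiniteMeasure (baryMeasure ρ.1) ∧ ∃ K, IsCompact K ∧ CarriedBy (baryMeasure ρ.1) K := by
  obtain ⟨ρ, hρ, K, hK, -, hKρ⟩ := ρ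
  have hae : ∀ᵐ z ∂ρ, z ∈ K := hKρ
  refine ⟨?_, Prod.fst '' K, hK.image continuous_fst, ?_⟩
  · obtain ⟨b, hb⟩ := (hK.image continuous_snd).bddAbove
    have : IsFiniteMeasure (ρ.withDensity fun z => ENNReal.ofReal z.2) := by
      refine isFiniteMeasure_withDensity (ne_of_lt ?_)
      calc ∫⁻ z, ENNReal.ofReal z.2 ∂ρ ≤ ∫⁻ _, ENNReal.ofReal b ∂ρ := by
            refine lintegral_mono_ae ?_
            filter_upwards [hae] with z hz
            exact ENNReal.ofReal_le_ofReal (hb ⟨z, hz, rfl⟩)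
        _ < ⊤ := by simp
    unfold baryMeasure
    infer_instance
  · have hm : MeasurableSet (Prod.fst '' K)ᶜ :=
      (hK.image continuous_fst).isClosed.measurableSet.compl
    unfold CarriedBy baryMeasure
    rw [Measure.map_apply measurable_fst hm]
    refine withDensity_absolutelyContinuous _ _ (measure_mono_null ?_ hKρ)
    intro z hz hzK
    exact hz ⟨z, hzK, rfl⟩

/-- The barycentric projection `β : 𝒴 → 𝒳`. -/
def bary {n : ℕ} (ρ : LiftedSpace n) : StateSpace n :=
  ⟨baryMeasure ρ.1, baryMeasure_mem ρ⟩

/-- The defining formula of the barycentric projection, `⟨β(ρ), φ⟩ = ∫ y φ(x) dρ(x, y)`. -/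
theorem integral_bary {n : ℕ} (ρ : LiftedSpace n) {φ : Rn n → ℝ} (hφ : Continuous φ) :
    ∫ x, φ x ∂(bary ρ).1 = ∫ z, z.2 * φ z.1 ∂ρ.1 := by
  obtain ⟨ρ, hρ, K, hK, hK0, hKρ⟩ := ρ
  have hae : ∀ᵐ z ∂ρ, z ∈ K := hKρ
  change ∫ x, φ x ∂(baryMeasure ρ) = ∫ z, z.2 * φ z.1 ∂ρ
  unfold baryMeasure
  rw [integral_map measurable_fst.aemeasurable hφ.measurable.aestronglyMeasurable,
    integral_withDensity_eq_integral_toReal_smul (by fun_prop) (by simp)]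
  refine integral_congr_ae ?_
  filter_upwards [hae] with z hz
  have : (0 : ℝ) ≤ z.2 := (hK0 hz).2
  simp [ENNReal.toReal_ofReal this]

/-- A nonlocal vector field `(t, u, μ, x) ↦ F_t(u, μ, x)`; only its values for `t ∈ [0, T]` and
`u` in the control set matter. -/
abbrev NonlocalField (m n : ℕ) : Type := ℝ → Rn m → StateSpace n → Rn n → Rn n

/-- A nonlocal source density `(t, u, μ, x) ↦ G_t(u, μ, x)`. -/
abbrev NonlocalDensity (m n : ℕ) : Type := ℝ → Rn m → StateSpace n → Rn n → ℝ

/-- The standing regularity hypotheses on `F` and `G`: continuity in `(t, u)`, local Lipschitz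
continuity in `(μ, x)`, uniformly in `(t, u)`, and sublinear growth. -/
structure RegularData {m n : ℕ} (T : ℝ) (U : Set (Rn m)) (F : NonlocalField m n)
    (G : NonlocalDensity m n) : Prop where
  continuous_F : ∀ μ x, ContinuousOn (fun p : ℝ × Rn m => F p.1 p.2 μ x) (Icc 0 T ×ˢ U)
  continuous_G : ∀ μ x, ContinuousOn (fun p : ℝ × Rn m => G p.1 p.2 μ x) (Icc 0 T ×ˢ U)
  lipschitz : ∀ E : Set (Rn n), IsCompact E → ∃ M : ℝ, 0 < M ∧
    ∀ t ∈ Icc 0 T, ∀ u ∈ U, ∀ μ μ' : StateSpace n, CarriedBy μ.1 E → CarriedBy μ'.1 E →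
      ∀ x ∈ E, ∀ x' ∈ E,
        ‖F t u μ x - F t u μ' x'‖ ≤ M * (‖x - x'‖ + krDist μ μ') ∧
        |G t u μ x - G t u μ' x'| ≤ M * (‖x - x'‖ + krDist μ μ')
  sublinear : ∃ C : ℝ, 0 < C ∧ ∀ t ∈ Icc 0 T, ∀ u ∈ U, ∀ (μ : StateSpace n) (x : Rn n),
    ‖F t u μ x‖ ≤ C * (1 + μ.1.real univ) ∧ |G t u μ x| ≤ C

/-- The class `𝒰 = L^∞([0, T]; U)` of admissible controls. -/
def Controls {m : ℕ} (T : ℝ) (U : Set (Rn m)) : Set (Lp (Rn m) ⊤ (volume.restrict (Icc 0 T))) :=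
  {u | ∀ᵐ t ∂(volume.restrict (Icc 0 T)), u t ∈ U}

/-- `μ : [0, T] → 𝒳` is a distributional solution of the nonlocal balance law
`∂ₜ μₜ + ∇ · [Fₜ(uₜ, μₜ) μₜ] = Gₜ(uₜ, μₜ) μₜ`, `μ₀ = ϑ`, for the control `u`. -/
structure SolvesBalance {m n : ℕ} (T : ℝ) (F : NonlocalField m n) (G : NonlocalDensity m n)
    (ϑ : StateSpace n) (u : ℝ → Rn m) (μ : ℝ → StateSpace n) : Prop where
  initial : μ 0 = ϑ
  absCont : ∀ φ : Rn n → ℝ, ContDiff ℝ 1 φ →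
    AbsolutelyContinuousOnInterval (fun t => ∫ x, φ x ∂(μ t).1) 0 T
  weak : ∀ φ : Rn n → ℝ, ContDiff ℝ 1 φ → ∀ᵐ t ∂(volume.restrict (Icc 0 T)),
    HasDerivAt (fun t => ∫ x, φ x ∂(μ t).1)
      (∫ x, (fderiv ℝ φ x (F t (u t) (μ t) x) + G t (u t) (μ t) x * φ x) ∂(μ t).1) t

/-- The lifted field `𝐅ₜ(u, ρ, (x, y)) = (Fₜ(u, β(ρ), x), y Gₜ(u, β(ρ), x))`. -/
def liftedField {m n : ℕ} (F : NonlocalField m n) (G : NonlocalDensity m n)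
    (t : ℝ) (u : Rn m) (ρ : LiftedSpace n) (z : Rn n × ℝ) : Rn n × ℝ :=
  (F t u (bary ρ) z.1, z.2 * G t u (bary ρ) z.1)

/-- `ρ : [0, T] → 𝒴` is a distributional solution of the lifted nonlocal continuity equation
`∂ₜ ρₜ + ∇ · [𝐅ₜ(uₜ, ρₜ) ρₜ] = 0`, `ρ₀ = ϑ ⊗ δ₁`, for the control `u`. The test functions are
the `C¹` functions on `ℝⁿ × [0, ∞)`, each given by a `C¹` extension to `ℝⁿ × ℝ`. -/
structure SolvesLifted {m n : ℕ} (T : ℝ) (F : NonlocalField m n) (G : NonlocalDensity m n)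
    (ϑ : StateSpace n) (u : ℝ → Rn m) (ρ : ℝ → LiftedSpace n) : Prop where
  initial : (ρ 0).1 = ϑ.1.prod (Measure.dirac 1)
  absCont : ∀ φ : Rn n × ℝ → ℝ, ContDiff ℝ 1 φ →
    AbsolutelyContinuousOnInterval (fun t => ∫ z, φ z ∂(ρ t).1) 0 T
  weak : ∀ φ : Rn n × ℝ → ℝ, ContDiff ℝ 1 φ → ∀ᵐ t ∂(volume.restrict (Icc 0 T)),
    HasDerivAt (fun t => ∫ z, φ z ∂(ρ t).1)
      (∫ z, fderiv ℝ φ z (liftedField F G t (u t) (ρ t) z) ∂(ρ t).1) t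

/-- `u` is an optimal control of the problem `ℓ(μ_T) → inf` over the controls `u ∈ 𝒰` and the
corresponding solutions `μ` of the balance law. -/
def IsOptimal {m n : ℕ} (T : ℝ) (U : Set (Rn m)) (F : NonlocalField m n)
    (G : NonlocalDensity m n) (ϑ : StateSpace n) (ℓ : StateSpace n → ℝ)
    (u : Lp (Rn m) ⊤ (volume.restrict (Icc 0 T))) : Prop :=
  u ∈ Controls T U ∧ ∃ μ, SolvesBalance T F G ϑ u μ ∧
    ∀ v ∈ Controls T U, ∀ ν, SolvesBalance T F G ϑ v ν → ℓ (μ T) ≤ ℓ (ν T)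

/-- `u` is an optimal control of the problem `ℓ(β(ρ_T)) → inf` over the controls `u ∈ 𝒰` and the
corresponding solutions `ρ` of the lifted continuity equation. -/
def IsOptimalLifted {m n : ℕ} (T : ℝ) (U : Set (Rn m)) (F : NonlocalField m n)
    (G : NonlocalDensity m n) (ϑ : StateSpace n) (ℓ : StateSpace n → ℝ)
    (u : Lp (Rn m) ⊤ (volume.restrict (Icc 0 T))) : Prop :=
  u ∈ Controls T U ∧ ∃ ρ, SolvesLifted T F G ϑ u ρ ∧
    ∀ v ∈ Controls T U, ∀ σ, SolvesLifted T F G ϑ v σ → ℓ (bary (ρ T)) ≤ ℓ (bary (σ T))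

end

end BalanceLaw

open BalanceLaw

/-!
Well-posedness of a nonlocal balance law and of its lift to a continuity equation on `ℝⁿ × ℝ⁺`,
and the equality of their optimal controls.

*Reduction.* If `ρ` solves the lifted equation, the test functions `(x, y) ↦ y φ(x)` show that
`β(ρ)` solves the balance law (`SolvesLifted.solvesBalance`). Hence existence is only needed for
the lifted equation, the identity `μₜ = β(ρₜ)` is uniqueness for the balance law, and two lifted
solutions have the same barycentric projection, so that they solve one and the same *linear*
continuity equation. The admissible pairs of the two control problems then correspond to each
other with equal costs.

*Uniqueness* (`WeakCurve.eq_of_initial_eq`). The characteristic flow is not differentiable in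
space, so that the dual transport equation has no `C¹` solutions to test with. Instead the
Kantorovich–Rubinstein distance is tested with mollified functions `η * φ` only. Over a time step
`δ`, the test function `φ` is propagated by the Euler step `φ ∘ (id + δ v) + δ g φ`; this commutes
with mollification up to `O(δ ε)`, where `ε` is the radius of the mollifier, plus `C(η) δ²`, where
`C(η)` comes from the Lipschitz constant of the gradient of `η * φ`. A discrete Grönwall argument,
with `δ → 0` first and `ε → 0` afterwards, gives uniqueness.

The argument needs bounded Lipschitz coefficients. They are obtained by truncation, since all
solutions are supported in a common compact set: the integrals of the test functions `exp (k w)`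
with `w(x) = √(1 + |x|²)` grow at most like `exp ((k V + C) t)`, where `V` bounds `F`, and letting
`k → ∞` bounds `w` on the support (`ae_le_add_of_integral_exp_le`). The variable `y` is treated in
the same way with `w = log (1 + y²)`.

*Existence* (`exists_solvesLifted`). A solution is the law of particles `(X, Y)` which start at
`(x, 1)`, with `x` distributed by `ϑ`, and follow `X' = F`, `Y' = Y G`. For the displacement and for
`log Y` this is an integral equation whose right-hand side is measurable in time only, solved by a
contraction for an exponentially weighted supremum norm (`CaratheodoryField.exists_solution`). The
bounds `|G| ≤ C` and `|F| ≤ C (1 + μ(ℝⁿ))` ensure that a truncation of the coefficients is never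
active along the solution.
-/

namespace BalanceLaw

open Filter Topology Metric

/-! ### Absolutely continuous functions with one-sided bounds on the derivative -/

theorem sub_le_of_ae_hasDerivAt_le {h h' : ℝ → ℝ} {T a b B : ℝ}
    (hh : AbsolutelyContinuousOnInterval h 0 T)
    (hd : ∀ᵐ t ∂(volume.restrict (Icc 0 T)), HasDerivAt h (h' t) t)
    (ha : 0 ≤ a) (hab : a ≤ b) (hb : b ≤ T)
    (hB : ∀ᵐ t ∂(volume.restrict (Icc 0 T)), t ∈ Icc a b → h' t ≤ B) :
    h b - h a ≤ B * (b - a) := by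
  have hsub : Icc a b ⊆ Icc 0 T := Icc_subset_Icc ha hb
  have hac : AbsolutelyContinuousOnInterval h a b :=
    hh.mono (by rwa [uIcc_of_le hab, uIcc_of_le (ha.trans (hab.trans hb))])
  rw [← hac.integral_deriv_eq_sub]
  have h1 : ∀ᵐ t ∂(volume.restrict (Icc a b)), deriv h t ≤ B := by
    have := ae_restrict_of_ae_restrict_of_subset hsub (hd.and hB)
    filter_upwards [this, ae_restrict_mem measurableSet_Icc] with t ht htm
    rw [ht.1.deriv]
    exact ht.2 htm
  calc ∫ t in a..b, deriv h t ≤ ∫ _ in a..b, B :=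
        intervalIntegral.integral_mono_ae_restrict hab hac.intervalIntegrable_deriv
          (by simp) h1
    _ = B * (b - a) := by simp [mul_comm]

/-- Grönwall's inequality for absolutely continuous functions. -/
theorem le_mul_exp_of_ae_hasDerivAt_le {h h' : ℝ → ℝ} {T K : ℝ}
    (hh : AbsolutelyContinuousOnInterval h 0 T)
    (hd : ∀ᵐ t ∂(volume.restrict (Icc 0 T)), HasDerivAt h (h' t) t)
    (hK : ∀ᵐ t ∂(volume.restrict (Icc 0 T)), h' t ≤ K * h t) {t : ℝ} (ht : t ∈ Icc 0 T) :
    h t ≤ h 0 * Real.exp (K * t) := by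
  have he : AbsolutelyContinuousOnInterval (fun s => Real.exp (-K * s)) 0 T :=
    ContDiffOn.absolutelyContinuousOnInterval (by fun_prop)
  have hd' : ∀ᵐ s ∂(volume.restrict (Icc 0 T)),
      HasDerivAt (fun s => h s * Real.exp (-K * s))
        (h' s * Real.exp (-K * s) + h s * (Real.exp (-K * s) * (-K * 1))) s := by
    filter_upwards [hd] with s hs
    exact hs.mul ((hasDerivAt_id s).const_mul (-K)).exp
  have key := sub_le_of_ae_hasDerivAt_le (B := 0) (hh.mul he) hd' le_rfl ht.1 ht.2 (by
    filter_upwards [hK] with s hs _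
    have := Real.exp_pos (-K * s)
    nlinarith)
  simp only [Pi.mul_apply, mul_zero, Real.exp_zero, mul_one, zero_mul, sub_nonpos] at key
  calc h t = h t * Real.exp (-K * t) * Real.exp (K * t) := by
        rw [mul_assoc, ← Real.exp_add]; simp
    _ ≤ _ := by gcongr

/-! ### Bounded Lipschitz test functions -/

/-- `φ` and its Lipschitz constant are both bounded by `c`. -/
def BLBound {E : Type*} [NormedAddCommGroup E] (c : ℝ) (φ : E → ℝ) : Prop :=
  (∀ x, |φ x| ≤ c) ∧ ∀ x y, |φ x - φ y| ≤ c * ‖x - y‖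

/-- `⟨μ - ν, φ⟩ ≤ a` for all `φ` bounded by one with Lipschitz constant one, that is,
the Kantorovich–Rubinstein distance of `μ` and `ν` is at most `a`. -/
def KRLe {E : Type*} [NormedAddCommGroup E] [MeasurableSpace E] (μ ν : Measure E) (a : ℝ) : Prop :=
  ∀ φ : E → ℝ, BLBound 1 φ → ∫ x, φ x ∂μ - ∫ x, φ x ∂ν ≤ a

theorem abs_integral_le_mul_real {X : Type*} [MeasurableSpace X] {μ : Measure X} [IsFiniteMeasure μ]
    {φ : X → ℝ} {c m : ℝ} (hc : 0 ≤ c) (hφ : ∀ x, |φ x| ≤ c) (hm : μ.real univ ≤ m) :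
    |∫ x, φ x ∂μ| ≤ c * m := by
  have := norm_integral_le_of_norm_le_const (μ := μ) (f := φ)
    (Eventually.of_forall fun x => (Real.norm_eq_abs _).le.trans (hφ x))
  rw [Real.norm_eq_abs] at this
  exact this.trans (by gcongr)

section

variable {E : Type*} [NormedAddCommGroup E]

theorem BLBound.lipschitzWith {c : ℝ} {φ : E → ℝ} (h : BLBound c φ) :
    LipschitzWith c.toNNReal φ := by
  refine LipschitzWith.of_dist_le' fun x y => ?_
  rw [Real.dist_eq, dist_eq_norm]
  exact h.2 x y

theorem BLBound.continuous {c : ℝ} {φ : E → ℝ} (h : BLBound c φ) : Continuous φ :=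
  h.lipschitzWith.continuous

theorem BLBound.nonneg {c : ℝ} {φ : E → ℝ} (h : BLBound c φ) : 0 ≤ c :=
  (abs_nonneg _).trans (h.1 0)

theorem BLBound.neg {c : ℝ} {φ : E → ℝ} (h : BLBound c φ) : BLBound c (fun x => -φ x) :=
  ⟨fun x => by simpa using h.1 x, fun x y => by
    have := h.2 y x
    rw [norm_sub_rev] at this
    convert this using 2
    ring⟩

theorem BLBound.mono {c d : ℝ} {φ : E → ℝ} (h : BLBound c φ) (hcd : c ≤ d) : BLBound d φ :=
  ⟨fun x => (h.1 x).trans hcd, fun x y => (h.2 x y).trans (by gcongr)⟩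

theorem BLBound.div {c : ℝ} {φ : E → ℝ} (h : BLBound c φ) (hc : 0 < c) :
    BLBound 1 (fun x => φ x / c) := by
  refine ⟨fun x => ?_, fun x y => ?_⟩
  · rw [abs_div, abs_of_pos hc, div_le_one hc]; exact h.1 x
  · rw [← sub_div, abs_div, abs_of_pos hc, div_le_iff₀ hc]
    calc _ ≤ _ := h.2 x y
      _ = _ := by ring

theorem BLBound.integrable [MeasurableSpace E] [BorelSpace E] [SecondCountableTopology E]
    {c : ℝ} {φ : E → ℝ} (h : BLBound c φ)
    (μ : Measure E) [IsFiniteMeasure μ] : Integrable φ μ :=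
  Integrable.of_bound h.continuous.aestronglyMeasurable c (Eventually.of_forall h.1)

theorem KRLe.mul_le [MeasurableSpace E] {μ ν : Measure E} {a c : ℝ} (h : KRLe μ ν a)
    {φ : E → ℝ} (hφ : BLBound c φ) (hc : 0 < c) :
    ∫ x, φ x ∂μ - ∫ x, φ x ∂ν ≤ c * a := by
  have := h _ (hφ.div hc)
  rw [integral_div, integral_div, ← sub_div, div_le_iff₀ hc] at this
  linarith

theorem KRLe.symm [MeasurableSpace E] {μ ν : Measure E} {a : ℝ} (h : KRLe μ ν a) :
    KRLe ν μ a := fun φ hφ => by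
  have := h _ hφ.neg
  rw [integral_neg, integral_neg] at this
  linarith

/-- Bounded Lipschitz functions separate finite measures: they approximate the indicator of
a closed set from above. -/
theorem measure_eq_of_forall_BLBound [MeasurableSpace E] [BorelSpace E]
    {μ ν : Measure E} [IsFiniteMeasure μ] [IsFiniteMeasure ν]
    (h : ∀ φ : E → ℝ, BLBound 1 φ → ∫ x, φ x ∂μ = ∫ x, φ x ∂ν) : μ = ν := by
  refine MeasureTheory.ext_of_generate_finite {s | IsClosed s}
    (by rw [BorelSpace.measurable_eq (α := E), borel_eq_generateFrom_isClosed]) isPiSystem_isClosed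
    (fun s hs => ?_) ?_
  · have hpos : ∀ n : ℕ, (0 : ℝ) < 1 / ((n : ℝ) + 1) := fun n => by positivity
    have key : ∀ κ : Measure E, IsFiniteMeasure κ →
        Tendsto (fun n : ℕ => ∫ x, ((thickenedIndicator (hpos n) s x : NNReal) : ℝ) ∂κ) atTop
          (𝓝 (κ.real s)) := fun κ _ =>
      tendsto_integral_thickenedIndicator_of_isClosed κ hs hpos
        tendsto_one_div_add_atTop_nhds_zero_nat
    have heq : ∀ n : ℕ, ∫ x, ((thickenedIndicator (hpos n) s x : NNReal) : ℝ) ∂μ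
        = ∫ x, ((thickenedIndicator (hpos n) s x : NNReal) : ℝ) ∂ν := by
      intro n
      have hBL : BLBound ((n : ℝ) + 1)
          (fun x : E => ((thickenedIndicator (hpos n) s x : NNReal) : ℝ)) := by
        refine ⟨fun x => ?_, fun x y => ?_⟩
        · rw [abs_of_nonneg (by positivity)]
          have : ((thickenedIndicator (hpos n) s x : NNReal) : ℝ) ≤ 1 := by
            exact_mod_cast thickenedIndicator_le_one (hpos n) s x
          have : (0 : ℝ) ≤ n := by positivity
          linarith
        · have := (lipschitzWith_thickenedIndicator (hpos n) s).dist_le_mul x y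
          rw [NNReal.dist_eq, dist_eq_norm] at this
          convert this using 2
          rw [NNReal.coe_inv, Real.coe_toNNReal _ (hpos n).le]
          simp
      have h2 := h _ (hBL.div (by positivity))
      rw [integral_div, integral_div, div_left_inj' (by positivity)] at h2
      exact h2
    have h1 := key μ inferInstance
    simp_rw [heq] at h1
    have := tendsto_nhds_unique h1 (key ν inferInstance)
    rwa [measureReal_eq_measureReal_iff] at this
  · have := h (fun _ => 1) ⟨by simp, by simp⟩
    simp only [integral_const, smul_eq_mul, mul_one] at this
    rwa [measureReal_eq_measureReal_iff] at this

end

/-! ### Mollification -/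

section

variable {E : Type*} [NormedAddCommGroup E] [NormedSpace ℝ E]

theorem abs_taylor_le {f : E → ℝ} (hf : ContDiff ℝ 1 f) {K : ℝ} (hK : 0 ≤ K)
    (hL : ∀ x y, ‖fderiv ℝ f x - fderiv ℝ f y‖ ≤ K * ‖x - y‖) (x d : E) :
    |f (x + d) - f x - fderiv ℝ f x d| ≤ K * ‖d‖ ^ 2 := by
  have := (convex_closedBall x ‖d‖).norm_image_sub_le_of_norm_fderiv_le' (𝕜 := ℝ) (f := f)
    (φ := fderiv ℝ f x) (C := K * ‖d‖) (x := x) (y := x + d)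
    (fun y _ => (hf.differentiable one_ne_zero).differentiableAt) (fun y hy => by
      refine (hL y x).trans ?_
      rw [mem_closedBall, dist_eq_norm] at hy
      gcongr) (by simp) (by simp)
  rw [add_sub_cancel_left, Real.norm_eq_abs] at this
  calc _ ≤ _ := this
    _ = _ := by ring

theorem norm_fderiv_le_of_BLBound {f : E → ℝ} {c : ℝ} (h : BLBound c f) (x : E) :
    ‖fderiv ℝ f x‖ ≤ c := by
  have := norm_fderiv_le_of_lipschitz ℝ h.lipschitzWith (x₀ := x)
  rwa [Real.coe_toNNReal _ h.nonneg] at this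

end

section

variable {E : Type*} [NormedAddCommGroup E] [NormedSpace ℝ E] [FiniteDimensional ℝ E]
  [MeasurableSpace E] [BorelSpace E]

/-- The mollification `x ↦ ∫ η(z) φ(x - z) dz` of `φ` by the normalized bump function `η`. -/
noncomputable def mollify (η : ContDiffBump (0 : E)) (φ : E → ℝ) (x : E) : ℝ :=
  ∫ z, η.normed Measure.addHaar z * φ (x - z) ∂Measure.addHaar

theorem integrable_normed_mul (η : ContDiffBump (0 : E)) {a : E → ℝ} (ha : Continuous a) :
    Integrable (fun z => η.normed Measure.addHaar z * a z) Measure.addHaar :=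
  (η.continuous_normed.mul ha).integrable_of_hasCompactSupport
    η.hasCompactSupport_normed.mul_right

/-- Averaging against `η` only sees the ball of radius `η.rOut`. -/
theorem abs_integral_normed_mul_sub_le (η : ContDiffBump (0 : E)) {a b : E → ℝ} {c : ℝ}
    (ha : Continuous a) (hb : Continuous b) (hc : ∀ z, ‖z‖ ≤ η.rOut → |a z - b z| ≤ c) :
    |∫ z, η.normed Measure.addHaar z * a z ∂Measure.addHaar
      - ∫ z, η.normed Measure.addHaar z * b z ∂Measure.addHaar| ≤ c := by
  rw [← integral_sub (integrable_normed_mul η ha) (integrable_normed_mul η hb)]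
  have hi : Integrable (fun z => η.normed Measure.addHaar z * c) (Measure.addHaar : Measure E) :=
    integrable_normed_mul η continuous_const
  calc _ = ‖∫ z, (η.normed Measure.addHaar z * a z - η.normed Measure.addHaar z * b z)
          ∂Measure.addHaar‖ := (Real.norm_eq_abs _).symm
    _ ≤ ∫ z, η.normed Measure.addHaar z * c ∂Measure.addHaar := by
        refine norm_integral_le_of_norm_le hi (Eventually.of_forall fun z => ?_)
        rw [← mul_sub, Real.norm_eq_abs, abs_mul, abs_of_nonneg (η.nonneg_normed z)]
        by_cases hz : ‖z‖ ≤ η.rOut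
        · exact mul_le_mul_of_nonneg_left (hc z hz) (η.nonneg_normed z)
        · have : η.normed Measure.addHaar z = 0 := by
            rw [← Function.notMem_support, η.support_normed_eq, mem_ball_zero_iff]
            linarith
          simp [this]
    _ = c := by rw [integral_mul_const, η.integral_normed, one_mul]

theorem integral_normed_mul_const (η : ContDiffBump (0 : E)) (c : ℝ) :
    ∫ z, η.normed Measure.addHaar z * c ∂Measure.addHaar = c := by
  rw [integral_mul_const, η.integral_normed, one_mul]

theorem mollify_BLBound (η : ContDiffBump (0 : E)) {c : ℝ} {φ : E → ℝ} (hφ : BLBound c φ) :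
    BLBound c (mollify η φ) := by
  have hcont : ∀ x, Continuous fun z => φ (x - z) := fun x =>
    hφ.continuous.comp (by fun_prop)
  refine ⟨fun x => ?_, fun x y => ?_⟩
  · have := abs_integral_normed_mul_sub_le (c := c) η (hcont x) (continuous_const (y := (0 : ℝ)))
      (fun z _ => by simpa using hφ.1 (x - z))
    simpa [mollify] using this
  · exact abs_integral_normed_mul_sub_le η (hcont x) (hcont y) fun z _ => by
      simpa using hφ.2 (x - z) (y - z)

theorem abs_mollify_sub_le (η : ContDiffBump (0 : E)) {c : ℝ} {φ : E → ℝ} (hφ : BLBound c φ)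
    (x : E) : |mollify η φ x - φ x| ≤ c * η.rOut := by
  have hc := hφ.nonneg
  have := abs_integral_normed_mul_sub_le (c := c * η.rOut) η (a := fun z => φ (x - z))
    (hφ.continuous.comp (by fun_prop)) (continuous_const (y := φ x)) (fun z hz => by
      refine (hφ.2 (x - z) x).trans ?_
      have : ‖x - z - x‖ = ‖z‖ := by rw [sub_sub_cancel_left, norm_neg]
      rw [this]
      gcongr)
  rwa [integral_normed_mul_const] at this

theorem mollify_eq_convolution (η : ContDiffBump (0 : E)) (φ : E → ℝ) :
    mollify η φ = MeasureTheory.convolution (η.normed Measure.addHaar) φ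
      (ContinuousLinearMap.lsmul ℝ ℝ) Measure.addHaar := by
  ext x
  simp [mollify, convolution_def]

theorem contDiff_mollify (η : ContDiffBump (0 : E)) {φ : E → ℝ} (hφ : Continuous φ) :
    ContDiff ℝ 1 (mollify η φ) := by
  rw [mollify_eq_convolution]
  exact η.hasCompactSupport_normed.contDiff_convolution_left _ (n := 1) η.contDiff_normed
    hφ.locallyIntegrable

/-- The gradient of the mollification of a `1`-Lipschitz function is Lipschitz, with a constant
that depends on the mollifier only. -/
theorem exists_lipschitz_fderiv_mollify (η : ContDiffBump (0 : E)) :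
    ∃ K : ℝ, 0 ≤ K ∧ ∀ φ : E → ℝ, BLBound 1 φ → ∀ x y,
      ‖fderiv ℝ (mollify η φ) x - fderiv ℝ (mollify η φ) y‖ ≤ K * ‖x - y‖ := by
  set ν : Measure E := Measure.addHaar
  have hη : ContDiff ℝ 1 (η.normed ν) := η.contDiff_normed (n := 1)
  have hcs : HasCompactSupport (fderiv ℝ (η.normed ν)) := η.hasCompactSupport_normed.fderiv ℝ
  have hcd : Continuous (fderiv ℝ (η.normed ν)) := hη.continuous_fderiv one_ne_zero
  refine ⟨∫ z, ‖fderiv ℝ (η.normed ν) z‖ ∂ν, integral_nonneg fun _ => norm_nonneg _, ?_⟩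
  intro φ hφ x y
  have hfd : ∀ x, fderiv ℝ (mollify η φ) x = ∫ z, φ (x - z) • fderiv ℝ (η.normed ν) z ∂ν := by
    intro x
    rw [mollify_eq_convolution]
    rw [(η.hasCompactSupport_normed.hasFDerivAt_convolution_left _ hη
      hφ.continuous.locallyIntegrable x).fderiv, convolution_def]
    refine integral_congr_ae (Eventually.of_forall fun z => ?_)
    ext d
    simp [ContinuousLinearMap.precompL_apply, mul_comm, ν]
  have hint : ∀ x, Integrable (fun z => φ (x - z) • fderiv ℝ (η.normed ν) z) ν := fun x =>
    ((hφ.continuous.comp (by fun_prop)).smul hcd).integrable_of_hasCompactSupport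
      hcs.smul_left
  rw [hfd, hfd, ← integral_sub (hint x) (hint y), ← integral_mul_const]
  refine norm_integral_le_of_norm_le
    ((hcd.norm.integrable_of_hasCompactSupport hcs.norm).mul_const _)
    (Eventually.of_forall fun z => ?_)
  rw [← sub_smul, norm_smul, mul_comm]
  have := hφ.2 (x - z) (y - z)
  rw [sub_sub_sub_cancel_right, one_mul] at this
  rw [Real.norm_eq_abs]
  gcongr

end

/-! ### Stability of weak solutions of balance laws -/

section

variable {E : Type*} [NormedAddCommGroup E] [NormedSpace ℝ E] [MeasurableSpace E]

/-- `μ` is a weak solution on `[0, T]` of the balance law `∂ₜ μₜ + ∇ · (vₜ μₜ) = gₜ μₜ`, with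
masses at most `m` and coefficients which are bounded by `V` and `L`-Lipschitz in space.
No regularity in time is asked of the coefficients. -/
structure WeakCurve (T m V L : ℝ) (v : ℝ → E → E) (g : ℝ → E → ℝ) (μ : ℝ → Measure E) : Prop where
  finite : ∀ t ∈ Icc 0 T, IsFiniteMeasure (μ t)
  mass : ∀ t ∈ Icc 0 T, (μ t).real univ ≤ m
  absCont : ∀ f : E → ℝ, ContDiff ℝ 1 f →
    AbsolutelyContinuousOnInterval (fun t => ∫ x, f x ∂(μ t)) 0 T
  weak : ∀ f : E → ℝ, ContDiff ℝ 1 f → ∀ᵐ t ∂(volume.restrict (Icc 0 T)),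
    HasDerivAt (fun t => ∫ x, f x ∂(μ t)) (∫ x, (fderiv ℝ f x (v t x) + g t x * f x) ∂(μ t)) t
  bound : ∀ᵐ t ∂(volume.restrict (Icc 0 T)), ∀ x, ‖v t x‖ ≤ V ∧ |g t x| ≤ V
  lip : ∀ᵐ t ∂(volume.restrict (Icc 0 T)), ∀ x y,
    ‖v t x - v t y‖ ≤ L * ‖x - y‖ ∧ |g t x - g t y| ≤ L * ‖x - y‖

end

section

variable {E : Type*} [NormedAddCommGroup E] [NormedSpace ℝ E]

theorem abs_fderiv_add_le {f : E → ℝ} (hf : BLBound 1 f) {V : ℝ} {x w : E} {γ : ℝ}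
    (hw : ‖w‖ ≤ V) (hγ : |γ| ≤ V) : |fderiv ℝ f x w + γ * f x| ≤ 2 * V := by
  have h1 : |fderiv ℝ f x w| ≤ V := by
    have := (fderiv ℝ f x).le_of_opNorm_le (norm_fderiv_le_of_BLBound hf x) w
    rw [Real.norm_eq_abs, one_mul] at this
    exact this.trans hw
  have h2 : |γ * f x| ≤ V := by
    rw [abs_mul]
    calc |γ| * |f x| ≤ V * 1 := by
          gcongr
          · exact (abs_nonneg _).trans hγ
          · exact hf.1 x
      _ = V := mul_one V
  calc _ ≤ _ := abs_add_le _ _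
    _ ≤ 2 * V := by linarith

theorem BLBound_fderiv_add {f : E → ℝ} (hf : BLBound 1 f) {K V L : ℝ}
    (hK : ∀ x y, ‖fderiv ℝ f x - fderiv ℝ f y‖ ≤ K * ‖x - y‖) (hK0 : 0 ≤ K)
    {v : E → E} {g : E → ℝ} (hL : 0 ≤ L) (hb : ∀ x, ‖v x‖ ≤ V ∧ |g x| ≤ V)
    (hl : ∀ x y, ‖v x - v y‖ ≤ L * ‖x - y‖ ∧ |g x - g y| ≤ L * ‖x - y‖) :
    BLBound (K * V + 2 * L + 2 * V) (fun x => fderiv ℝ f x (v x) + g x * f x) := by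
  have hV : 0 ≤ V := (norm_nonneg _).trans (hb 0).1
  refine ⟨fun x => (abs_fderiv_add_le hf (hb x).1 (hb x).2).trans
    (by have := mul_nonneg hK0 hV; linarith), fun x y => ?_⟩
  have h1 : |(fderiv ℝ f x - fderiv ℝ f y) (v x)| ≤ K * ‖x - y‖ * V := by
    have := (fderiv ℝ f x - fderiv ℝ f y).le_of_opNorm_le (hK x y) (v x)
    refine this.trans ?_
    gcongr
    exact (hb x).1
  have h2 : |fderiv ℝ f y (v x - v y)| ≤ L * ‖x - y‖ := by
    have := (fderiv ℝ f y).le_of_opNorm_le (norm_fderiv_le_of_BLBound hf y) (v x - v y)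
    rw [Real.norm_eq_abs, one_mul] at this
    exact this.trans (hl x y).1
  have h3 : |(g x - g y) * f x| ≤ L * ‖x - y‖ := by
    rw [abs_mul]
    calc _ ≤ L * ‖x - y‖ * 1 := by
          gcongr
          exacts [(hl x y).2, hf.1 x]
      _ = _ := mul_one _
  have h4 : |g y * (f x - f y)| ≤ V * ‖x - y‖ := by
    rw [abs_mul]
    gcongr
    · exact (hb y).2
    · simpa using hf.2 x y
  have e : fderiv ℝ f x (v x) + g x * f x - (fderiv ℝ f y (v y) + g y * f y)
      = (fderiv ℝ f x - fderiv ℝ f y) (v x) + fderiv ℝ f y (v x - v y)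
        + (g x - g y) * f x + g y * (f x - f y) := by
    simp only [sub_apply, map_sub]; ring
  rw [e]
  have h5 := abs_add_le ((fderiv ℝ f x - fderiv ℝ f y) (v x) + fderiv ℝ f y (v x - v y)
        + (g x - g y) * f x) (g y * (f x - f y))
  have h6 := abs_add_three ((fderiv ℝ f x - fderiv ℝ f y) (v x)) (fderiv ℝ f y (v x - v y))
        ((g x - g y) * f x)
  have : 0 ≤ V * ‖x - y‖ := by positivity
  nlinarith

/-- One step of length `δ` of the dual Euler scheme: the test function `φ` at the end of the
step is replaced by `φ ∘ (id + δ v) + δ g φ` at its beginning. -/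
theorem BLBound_eulerStep {φ : E → ℝ} (hφ : BLBound 1 φ) {V L δ : ℝ}
    {v : E → E} {g : E → ℝ} (hL : 0 ≤ L) (hδ : 0 ≤ δ) (hb : ∀ x, ‖v x‖ ≤ V ∧ |g x| ≤ V)
    (hl : ∀ x y, ‖v x - v y‖ ≤ L * ‖x - y‖ ∧ |g x - g y| ≤ L * ‖x - y‖) :
    BLBound (1 + δ * (2 * L + V)) (fun x => φ (x + δ • v x) + δ * (g x * φ x)) := by
  have hV : 0 ≤ V := (norm_nonneg _).trans (hb 0).1
  refine ⟨fun x => ?_, fun x y => ?_⟩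
  · have h1 := hφ.1 (x + δ • v x)
    have h2 : |δ * (g x * φ x)| ≤ δ * (V * 1) := by
      rw [abs_mul, abs_mul, abs_of_nonneg hδ]
      gcongr
      exacts [(hb x).2, hφ.1 x]
    have h3 : 0 ≤ δ * L := by positivity
    refine (abs_add_le _ _).trans ?_
    linarith
  · have h1 : |φ (x + δ • v x) - φ (y + δ • v y)| ≤ ‖x - y‖ + δ * (L * ‖x - y‖) := by
      refine (hφ.2 _ _).trans ?_
      rw [one_mul, show x + δ • v x - (y + δ • v y) = (x - y) + δ • (v x - v y) by
        rw [smul_sub]; abel]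
      refine (norm_add_le _ _).trans ?_
      rw [norm_smul, Real.norm_eq_abs, abs_of_nonneg hδ]
      gcongr
      exact (hl x y).1
    have h3 : |δ * ((g x - g y) * φ x)| ≤ δ * (L * ‖x - y‖ * 1) := by
      rw [abs_mul, abs_mul, abs_of_nonneg hδ]
      gcongr
      exacts [(hl x y).2, hφ.1 x]
    have h4 : |δ * (g y * (φ x - φ y))| ≤ δ * (V * ‖x - y‖) := by
      rw [abs_mul, abs_mul, abs_of_nonneg hδ]
      gcongr
      · exact (hb y).2
      · simpa using hφ.2 x y
    have e : φ (x + δ • v x) + δ * (g x * φ x) - (φ (y + δ • v y) + δ * (g y * φ y))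
        = (φ (x + δ • v x) - φ (y + δ • v y)) + δ * ((g x - g y) * φ x)
          + δ * (g y * (φ x - φ y)) := by ring
    rw [e]
    refine (abs_add_three _ _ _).trans ?_
    linarith

end

section

variable {E : Type*} [NormedAddCommGroup E] [NormedSpace ℝ E] [FiniteDimensional ℝ E]
  [MeasurableSpace E] [BorelSpace E]

/-- Mollification commutes with the dual Euler step up to `O(δ² + δ ε)`, where `ε` is the radius
of the mollifier. -/
theorem abs_mollify_eulerStep_sub_le (η : ContDiffBump (0 : E)) {K : ℝ} (hK0 : 0 ≤ K)
    {φ : E → ℝ} (hφ : BLBound 1 φ)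
    (hK : ∀ x y, ‖fderiv ℝ (mollify η φ) x - fderiv ℝ (mollify η φ) y‖ ≤ K * ‖x - y‖)
    {V L δ : ℝ} {v : E → E} {g : E → ℝ} (hL : 0 ≤ L) (hδ : 0 ≤ δ)
    (hb : ∀ x, ‖v x‖ ≤ V ∧ |g x| ≤ V)
    (hl : ∀ x y, ‖v x - v y‖ ≤ L * ‖x - y‖ ∧ |g x - g y| ≤ L * ‖x - y‖) (x : E) :
    |mollify η φ x + δ * (fderiv ℝ (mollify η φ) x (v x) + g x * mollify η φ x)
      - mollify η (fun x => φ (x + δ • v x) + δ * (g x * φ x)) x|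
      ≤ K * δ ^ 2 * V ^ 2 + 2 * δ * L * η.rOut := by
  have hV : 0 ≤ V := (norm_nonneg _).trans (hb 0).1
  have hχ := BLBound_eulerStep hφ hL hδ hb hl
  have hc := hφ.continuous
  have h1 := abs_taylor_le (contDiff_mollify η hc) hK0 hK x (δ • v x)
  have h1' : K * ‖δ • v x‖ ^ 2 ≤ K * δ ^ 2 * V ^ 2 := by
    rw [norm_smul, Real.norm_eq_abs, abs_of_nonneg hδ, mul_pow, ← mul_assoc]
    gcongr
    exact (hb x).1
  have h2 := abs_integral_normed_mul_sub_le η (c := 2 * δ * L * η.rOut)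
    (a := fun z => φ (x + δ • v x - z) + δ * (g x * φ (x - z)))
    (b := fun z => φ (x - z + δ • v (x - z)) + δ * (g (x - z) * φ (x - z)))
    (by fun_prop) (hχ.continuous.comp (by fun_prop : Continuous fun z : E => x - z))
    (fun z hz => by
      have hl' := hl x (x - z)
      rw [sub_sub_cancel] at hl'
      have h3 : |φ (x + δ • v x - z) - φ (x - z + δ • v (x - z))| ≤ δ * (L * η.rOut) := by
        refine (hφ.2 _ _).trans ?_
        rw [one_mul, show x + δ • v x - z - (x - z + δ • v (x - z)) = δ • (v x - v (x - z)) by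
          rw [smul_sub]; abel, norm_smul, Real.norm_eq_abs, abs_of_nonneg hδ]
        have := hl'.1
        gcongr
        exact this.trans (by gcongr)
      have h4 : |δ * ((g x - g (x - z)) * φ (x - z))| ≤ δ * (L * η.rOut * 1) := by
        rw [abs_mul, abs_mul, abs_of_nonneg hδ]
        have h5 : |g x - g (x - z)| ≤ L * η.rOut := hl'.2.trans (by gcongr)
        have h6 := hφ.1 (x - z)
        have := η.rOut_pos
        exact mul_le_mul_of_nonneg_left
          (mul_le_mul h5 h6 (abs_nonneg _) (by positivity)) hδ
      have e : φ (x + δ • v x - z) + δ * (g x * φ (x - z))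
          - (φ (x - z + δ • v (x - z)) + δ * (g (x - z) * φ (x - z)))
          = (φ (x + δ • v x - z) - φ (x - z + δ • v (x - z)))
            + δ * ((g x - g (x - z)) * φ (x - z)) := by ring
      rw [e]
      refine (abs_add_le _ _).trans ?_
      linarith)
  have e2 : ∫ z, η.normed Measure.addHaar z * (φ (x + δ • v x - z) + δ * (g x * φ (x - z)))
      ∂Measure.addHaar = mollify η φ (x + δ • v x) + δ * (g x * mollify η φ x) := by
    unfold mollify
    rw [← integral_const_mul, ← integral_const_mul, ← integral_add]
    · congr 1; ext z; ring
    · exact integrable_normed_mul η (by fun_prop)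
    · exact ((integrable_normed_mul η (a := fun z => φ (x - z))
        (by fun_prop)).const_mul _).const_mul _
  rw [e2] at h2
  change |_ - mollify η (fun x => φ (x + δ • v x) + δ * (g x * φ x)) x| ≤ _ at h2
  rw [map_smul, smul_eq_mul] at h1
  rw [abs_le] at h1 h2 ⊢
  constructor <;> linarith [h1.1, h1.2, h2.1, h2.2]

theorem exists_contDiffBump_rOut (E : Type*) [NormedAddCommGroup E] [NormedSpace ℝ E]
    {ε : ℝ} (hε : 0 < ε) : ∃ η : ContDiffBump (0 : E), η.rOut = ε :=
  ⟨⟨ε / 2, ε, by positivity, by linarith⟩, rfl⟩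

theorem abs_integral_mollify_sub_le (η : ContDiffBump (0 : E)) {φ : E → ℝ} (hφ : BLBound 1 φ)
    {μ : Measure E} [IsFiniteMeasure μ] {m : ℝ} (hm : μ.real univ ≤ m) :
    |∫ x, mollify η φ x ∂μ - ∫ x, φ x ∂μ| ≤ η.rOut * m := by
  rw [← integral_sub ((mollify_BLBound η hφ).integrable μ) (hφ.integrable μ)]
  exact abs_integral_le_mul_real η.rOut_pos.le
    (fun x => by simpa using abs_mollify_sub_le η hφ x) hm

/-- A weak solution is Lipschitz continuous in time for the Kantorovich–Rubinstein distance. -/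
theorem WeakCurve.KRLe_of_le {T m V L : ℝ} {v : ℝ → E → E} {g : ℝ → E → ℝ} {μ : ℝ → Measure E}
    (h : WeakCurve T m V L v g μ) (hV : 0 ≤ V) (hm : 0 ≤ m) {s t : ℝ} (hs : 0 ≤ s) (hst : s ≤ t)
    (ht : t ≤ T) : KRLe (μ t) (μ s) (2 * V * m * (t - s)) := by
  intro φ hφ
  have := h.finite t ⟨hs.trans hst, ht⟩
  have := h.finite s ⟨hs, hst.trans ht⟩
  refine le_of_forall_pos_le_add fun ε hε => ?_
  obtain ⟨η, hη⟩ := exists_contDiffBump_rOut E (ε := ε / (2 * (m + 1))) (by positivity)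
  have hf := mollify_BLBound η hφ
  have hc := contDiff_mollify η hφ.continuous
  have key := sub_le_of_ae_hasDerivAt_le (B := 2 * V * m) (h.absCont _ hc) (h.weak _ hc) hs hst ht
    (by
      filter_upwards [h.bound, ae_restrict_mem measurableSet_Icc] with r hr hrm _
      have := h.finite r hrm
      exact (le_abs_self _).trans (abs_integral_le_mul_real (by positivity)
        (fun x => abs_fderiv_add_le hf (hr x).1 (hr x).2) (h.mass r hrm)))
  have h1 := abs_integral_mollify_sub_le η hφ (h.mass t ⟨hs.trans hst, ht⟩)
  have h2 := abs_integral_mollify_sub_le η hφ (h.mass s ⟨hs, hst.trans ht⟩)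
  have h3 : 2 * (η.rOut * m) ≤ ε := by
    rw [hη]
    have : ε / (2 * (m + 1)) * m = ε / 2 * (m / (m + 1)) := by field_simp
    have h4 : m / (m + 1) ≤ 1 := by rw [div_le_one (by positivity)]; linarith
    nlinarith
  rw [abs_le] at h1 h2
  linarith [h1.1, h1.2, h2.1, h2.2]

/-- The error made in one time step of length `δ` when the mollified Kantorovich–Rubinstein
distance of two weak solutions is propagated by the dual Euler scheme. -/
theorem WeakCurve.mollified_step {T m V L M : ℝ} {v₁ v₂ : ℝ → E → E} {g₁ g₂ : ℝ → E → ℝ}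
    {μ₁ μ₂ : ℝ → Measure E} (h₁ : WeakCurve T m V L v₁ g₁ μ₁) (h₂ : WeakCurve T m V L v₂ g₂ μ₂)
    (hm : 0 ≤ m) (hV : 0 ≤ V) (hL : 0 ≤ L)
    (hv : ∀ᵐ r ∂(volume.restrict (Icc 0 T)), ∀ a, KRLe (μ₁ r) (μ₂ r) a →
      ∀ x, ‖v₁ r x - v₂ r x‖ ≤ M * a ∧ |g₁ r x - g₂ r x| ≤ M * a)
    (η : ContDiffBump (0 : E)) {K : ℝ} (hK0 : 0 ≤ K)
    (hK : ∀ φ : E → ℝ, BLBound 1 φ → ∀ x y,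
      ‖fderiv ℝ (mollify η φ) x - fderiv ℝ (mollify η φ) y‖ ≤ K * ‖x - y‖)
    {t δ a : ℝ} (ht : 0 ≤ t) (hδ : 0 < δ) (htT : t + δ ≤ T)
    (ha : ∀ φ : E → ℝ, BLBound 1 φ →
      ∫ x, mollify η φ x ∂(μ₁ t) - ∫ x, mollify η φ x ∂(μ₂ t) ≤ a)
    {φ : E → ℝ} (hφ : BLBound 1 φ) :
    ∫ x, mollify η φ x ∂(μ₁ (t + δ)) - ∫ x, mollify η φ x ∂(μ₂ (t + δ))
      ≤ (1 + δ * (2 * L + V + 2 * M * m)) * a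
        + δ * ((4 * m * L + 4 * M * m ^ 2) * η.rOut
          + (2 * m * K * V ^ 2 + 2 * (K * V + 2 * L + 2 * V) * (2 * V * m)
            + 4 * M * m * (2 * V * m)) * δ) := by
  have htm : t ∈ Icc 0 T := ⟨ht, by linarith⟩
  have hf := mollify_BLBound η hφ
  have hcd := contDiff_mollify η hφ.continuous
  have := h₁.finite t htm
  have := h₂.finite t htm
  set N := 2 * V * m with hN
  have hN0 : 0 ≤ N := by positivity
  set Kq := K * V + 2 * L + 2 * V with hKq
  have hε := η.rOut_pos
  set ε := η.rOut
  -- the distance of the two solutions at time `t`, without mollification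
  have hKRt : KRLe (μ₁ t) (μ₂ t) (a + 2 * (ε * m)) := fun ψ hψ => by
    have h1 := abs_integral_mollify_sub_le η hψ (h₁.mass t htm)
    have h2 := abs_integral_mollify_sub_le η hψ (h₂.mass t htm)
    have h3 := ha ψ hψ
    rw [abs_le] at h1 h2
    linarith [h1.1, h1.2, h2.1, h2.2]
  set f := mollify η φ
  set R := (1 + δ * (2 * L + V)) * a + 2 * m * (K * δ ^ 2 * V ^ 2 + 2 * δ * L * ε)
    + δ * (2 * (Kq * (N * δ)) + 2 * M * m * (a + 2 * (ε * m) + 2 * (N * δ))) with hR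
  have key := sub_le_of_ae_hasDerivAt_le (a := t) (b := t + δ) (T := T)
    (B := (R - (∫ x, f x ∂(μ₁ t) - ∫ x, f x ∂(μ₂ t))) / δ)
    ((h₁.absCont f hcd).sub (h₂.absCont f hcd))
    (h' := fun r => ∫ x, (fderiv ℝ f x (v₁ r x) + g₁ r x * f x) ∂(μ₁ r)
      - ∫ x, (fderiv ℝ f x (v₂ r x) + g₂ r x * f x) ∂(μ₂ r))
    (by
      filter_upwards [h₁.weak f hcd, h₂.weak f hcd] with r hr1 hr2
      exact hr1.sub hr2) ht (by linarith) htT (by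
      filter_upwards [h₁.bound, h₂.bound, h₁.lip, h₂.lip, hv, ae_restrict_mem measurableSet_Icc]
        with r hb1 hb2 hl1 hl2 hvr hrm hr
      have := h₁.finite r hrm
      have := h₂.finite r hrm
      have hq1 := BLBound_fderiv_add hf (hK φ hφ) hK0 hL hb1 hl1
      have hq2 := BLBound_fderiv_add hf (hK φ hφ) hK0 hL hb2 hl2
      rw [← hKq] at hq1 hq2
      set q₁ : E → ℝ := fun x => fderiv ℝ f x (v₁ r x) + g₁ r x * f x
      set q₂ : E → ℝ := fun x => fderiv ℝ f x (v₂ r x) + g₂ r x * f x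
      have hrt : r - t ≤ δ := by linarith [hr.2]
      have hNδ : N * (r - t) ≤ N * δ := by gcongr
      have hk1 := h₁.KRLe_of_le hV hm ht hr.1 hrm.2
      have hk2 := (h₂.KRLe_of_le hV hm ht hr.1 hrm.2).symm
      rw [← hN] at hk1 hk2
      have hKRr : KRLe (μ₁ r) (μ₂ r) (a + 2 * (ε * m) + 2 * (N * δ)) := fun ψ hψ => by
        have h1 := hk1 ψ hψ
        have h2 := hk2 ψ hψ
        have h3 := hKRt ψ hψ
        linarith
      -- the coefficients of the second solution are replaced by those of the first one
      have hdiff : |∫ x, (q₁ x - q₂ x) ∂(μ₂ r)|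
          ≤ 2 * M * (a + 2 * (ε * m) + 2 * (N * δ)) * m := by
        have h0 : 0 ≤ M * (a + 2 * (ε * m) + 2 * (N * δ)) :=
          (norm_nonneg _).trans (hvr _ hKRr 0).1
        refine abs_integral_le_mul_real (by linarith) (fun x => ?_) (h₂.mass r hrm)
        have := abs_fderiv_add_le (x := x) hf (hvr _ hKRr x).1 (hvr _ hKRr x).2
        rw [map_sub] at this
        convert this using 1
        · congr 1; simp only [q₁, q₂]; ring
        · ring
      rw [integral_sub (hq1.integrable _) (hq2.integrable _)] at hdiff
      -- the measures are frozen at time `t`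
      have hfreeze : ∫ x, q₁ x ∂(μ₁ r) - ∫ x, q₁ x ∂(μ₂ r)
          ≤ ∫ x, q₁ x ∂(μ₁ t) - ∫ x, q₁ x ∂(μ₂ t) + 2 * (Kq * (N * δ)) := by
        rcases hq1.nonneg.eq_or_lt with h0 | h0
        · have : ∀ x, q₁ x = 0 := fun x => by
            have := hq1.1 x
            rw [← h0] at this
            exact abs_nonpos_iff.1 this
          simp [this, ← h0]
        · have h1 := hk1.mul_le hq1 h0
          have h2 := hk2.mul_le hq1 h0
          have h3 : Kq * (N * (r - t)) ≤ Kq * (N * δ) := by gcongr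
          linarith
      -- the dual Euler step is applied to the test function
      have heuler : (∫ x, f x ∂(μ₁ t) - ∫ x, f x ∂(μ₂ t))
          + δ * (∫ x, q₁ x ∂(μ₁ t) - ∫ x, q₁ x ∂(μ₂ t))
          ≤ (1 + δ * (2 * L + V)) * a + 2 * m * (K * δ ^ 2 * V ^ 2 + 2 * δ * L * ε) := by
        have hχ := BLBound_eulerStep hφ hL hδ.le hb1 hl1
        set χ : E → ℝ := fun x => φ (x + δ • v₁ r x) + δ * (g₁ r x * φ x)
        have herr := abs_mollify_eulerStep_sub_le η hK0 hφ (hK φ hφ) hL hδ.le hb1 hl1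
        have hχm := mollify_BLBound η hχ
        have hE : ∀ κ : Measure E, IsFiniteMeasure κ → κ.real univ ≤ m →
            |(∫ x, f x ∂κ + δ * ∫ x, q₁ x ∂κ) - ∫ x, mollify η χ x ∂κ|
              ≤ (K * δ ^ 2 * V ^ 2 + 2 * δ * L * ε) * m := by
          intro κ _ hκ
          rw [← integral_const_mul,
            ← integral_add (hf.integrable κ) ((hq1.integrable κ).const_mul δ),
            ← integral_sub (f := fun x => f x + δ * q₁ x)
              ((hf.integrable κ).add ((hq1.integrable κ).const_mul δ)) (hχm.integrable κ)]
          exact abs_integral_le_mul_real (by positivity) herr hκ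
        have e1 := hE (μ₁ t) inferInstance (h₁.mass t htm)
        have e2 := hE (μ₂ t) inferInstance (h₂.mass t htm)
        have hcpos : 0 < 1 + δ * (2 * L + V) := by positivity
        have e3 := ha _ (hχ.div hcpos)
        have e4 : ∀ x, mollify η (fun x => χ x / (1 + δ * (2 * L + V))) x
            = mollify η χ x / (1 + δ * (2 * L + V)) := fun x => by
          unfold mollify
          rw [← integral_div]
          congr 1; ext z; ring
        simp_rw [e4] at e3
        rw [integral_div, integral_div, ← sub_div, div_le_iff₀ hcpos] at e3
        rw [abs_le] at e1 e2
        linarith [e1.1, e1.2, e2.1, e2.2]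
      rw [abs_le] at hdiff
      rw [le_div_iff₀ hδ]
      have h5 : ∫ x, q₁ x ∂(μ₁ r) - ∫ x, q₂ x ∂(μ₂ r)
          ≤ ∫ x, q₁ x ∂(μ₁ t) - ∫ x, q₁ x ∂(μ₂ t) + (2 * (Kq * (N * δ))
            + 2 * M * m * (a + 2 * (ε * m) + 2 * (N * δ))) := by
        linarith [hdiff.1, hdiff.2]
      have h6 := mul_le_mul_of_nonneg_left h5 hδ.le
      rw [hR]
      linarith)
  rw [add_sub_cancel_left, div_mul_cancel₀ _ hδ.ne'] at key
  simp only [Pi.sub_apply] at key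
  have h7 : ∫ x, f x ∂(μ₁ (t + δ)) - ∫ x, f x ∂(μ₂ (t + δ)) ≤ R := by linarith
  refine h7.trans (le_of_eq ?_)
  rw [hR]
  ring

/-- Uniqueness for nonlocal balance laws: two weak solutions with the same initial datum agree if
the difference of their coefficients is controlled by their Kantorovich–Rubinstein distance. -/
theorem WeakCurve.eq_of_initial_eq {T m V L M : ℝ} {v₁ v₂ : ℝ → E → E} {g₁ g₂ : ℝ → E → ℝ}
    {μ₁ μ₂ : ℝ → Measure E} (h₁ : WeakCurve T m V L v₁ g₁ μ₁) (h₂ : WeakCurve T m V L v₂ g₂ μ₂)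
    (hm : 0 ≤ m) (hV : 0 ≤ V) (hL : 0 ≤ L) (hM : 0 ≤ M)
    (hv : ∀ᵐ r ∂(volume.restrict (Icc 0 T)), ∀ a, KRLe (μ₁ r) (μ₂ r) a →
      ∀ x, ‖v₁ r x - v₂ r x‖ ≤ M * a ∧ |g₁ r x - g₂ r x| ≤ M * a)
    (h0 : μ₁ 0 = μ₂ 0) {t : ℝ} (ht : t ∈ Icc 0 T) : μ₁ t = μ₂ t := by
  rcases ht.1.eq_or_lt with rfl | htpos
  · exact h0
  have := h₁.finite t ht
  have := h₂.finite t ht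
  have main : ∀ φ : E → ℝ, BLBound 1 φ → ∫ x, φ x ∂(μ₁ t) - ∫ x, φ x ∂(μ₂ t) ≤ 0 := by
    intro φ hφ
    set c₁ := 2 * L + V + 2 * M * m with hc₁
    set c₂ := 4 * m * L + 4 * M * m ^ 2 with hc₂
    have hc₁0 : 0 ≤ c₁ := by positivity
    have hc₂0 : 0 ≤ c₂ := by positivity
    set A := t * c₂ * Real.exp (c₁ * t) + 2 * m with hA
    have hA0 : 0 ≤ A := by positivity
    -- with a fixed mollifier, the length of the time steps tends to zero
    have hmoll : ∀ η : ContDiffBump (0 : E),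
        ∫ x, φ x ∂(μ₁ t) - ∫ x, φ x ∂(μ₂ t) ≤ A * η.rOut := by
      intro η
      obtain ⟨K, hK0, hK⟩ := exists_lipschitz_fderiv_mollify η
      have hε := η.rOut_pos
      set c₃ := 2 * m * K * V ^ 2 + 2 * (K * V + 2 * L + 2 * V) * (2 * V * m)
        + 4 * M * m * (2 * V * m) with hc₃
      have hc₃0 : 0 ≤ c₃ := by positivity
      have hN : ∀ N : ℕ, ∫ x, mollify η φ x ∂(μ₁ t) - ∫ x, mollify η φ x ∂(μ₂ t)
          ≤ t * (c₂ * η.rOut + c₃ * (t * (1 / ((N : ℝ) + 1)))) * Real.exp (c₁ * t) := by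
        intro N
        set δ := t * (1 / ((N : ℝ) + 1)) with hδ
        have hδ0 : 0 < δ := by positivity
        have hNδ : ((N + 1 : ℕ) : ℝ) * δ = t := by
          rw [hδ]; push_cast; field_simp
        set b := c₂ * η.rOut + c₃ * δ with hb
        have hb0 : 0 ≤ b := by positivity
        have hind : ∀ k : ℕ, k ≤ N + 1 → ∀ ψ : E → ℝ, BLBound 1 ψ →
            ∫ x, mollify η ψ x ∂(μ₁ (k * δ)) - ∫ x, mollify η ψ x ∂(μ₂ (k * δ))
              ≤ k * δ * b * Real.exp (c₁ * (k * δ)) := by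
          intro k
          induction k with
          | zero => intro _ ψ _; simp [h0]
          | succ k ih =>
            intro hk ψ hψ
            have hk' : ((k + 1 : ℕ) : ℝ) * δ ≤ t := by
              rw [← hNδ]; gcongr
            have e : ((k + 1 : ℕ) : ℝ) * δ = k * δ + δ := by push_cast; ring
            rw [e] at hk' ⊢
            refine (h₁.mollified_step h₂ hm hV hL hv η hK0 hK (by positivity) hδ0
              (hk'.trans ht.2) (ih (by omega)) hψ).trans ?_
            rw [← hc₁, ← hc₂, ← hc₃, ← hb]
            have h1 : 1 + δ * c₁ ≤ Real.exp (c₁ * δ) := by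
              have := Real.add_one_le_exp (c₁ * δ); linarith
            have h2 : Real.exp (c₁ * (k * δ + δ))
                = Real.exp (c₁ * (k * δ)) * Real.exp (c₁ * δ) := by
              rw [← Real.exp_add]; ring_nf
            have h3 : 1 ≤ Real.exp (c₁ * (k * δ + δ)) := Real.one_le_exp (by positivity)
            calc _ ≤ Real.exp (c₁ * δ) * (k * δ * b * Real.exp (c₁ * (k * δ)))
                  + δ * b * Real.exp (c₁ * (k * δ + δ)) := by
                  refine add_le_add (by gcongr) ?_
                  exact le_mul_of_one_le_right (by positivity) h3
              _ = (k * δ + δ) * b * Real.exp (c₁ * (k * δ + δ)) := by rw [h2]; ring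
        have := hind (N + 1) le_rfl φ hφ
        rwa [hNδ] at this
      have hlim : Tendsto
          (fun N : ℕ => t * (c₂ * η.rOut + c₃ * (t * (1 / ((N : ℝ) + 1)))) * Real.exp (c₁ * t))
          atTop (𝓝 (t * (c₂ * η.rOut + c₃ * (t * 0)) * Real.exp (c₁ * t))) :=
        ((((tendsto_one_div_add_atTop_nhds_zero_nat.const_mul t).const_mul c₃).const_add
          (c₂ * η.rOut)).const_mul t).mul_const _
      have h3 := ge_of_tendsto hlim (Eventually.of_forall hN)
      have h4 := abs_integral_mollify_sub_le η hφ (h₁.mass t ht)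
      have h5 := abs_integral_mollify_sub_le η hφ (h₂.mass t ht)
      rw [abs_le] at h4 h5
      rw [hA]
      linarith [h4.1, h4.2, h5.1, h5.2]
    refine le_of_forall_pos_le_add fun ε hε => ?_
    obtain ⟨η, hη⟩ := exists_contDiffBump_rOut E (ε := ε / (A + 1)) (by positivity)
    refine (hmoll η).trans ?_
    rw [hη, zero_add, mul_div_assoc', div_le_iff₀ (by positivity)]
    nlinarith
  refine measure_eq_of_forall_BLBound fun φ hφ => ?_
  have h1 := main φ hφ
  have h2 := main _ hφ.neg
  rw [integral_neg, integral_neg] at h2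
  linarith

end

/-! ### Compactly supported measures -/

theorem integrable_of_carriedBy {X : Type*} [TopologicalSpace X] [T2Space X] [MeasurableSpace X]
    [OpensMeasurableSpace X] {μ : Measure X} [IsFiniteMeasure μ] {K : Set X}
    (hK : IsCompact K) (hμ : CarriedBy μ K) {φ : X → ℝ} (hφ : Continuous φ) : Integrable φ μ := by
  have h : ∀ᵐ x ∂μ, x ∈ K := hμ
  have := hφ.continuousOn.integrableOn_compact (μ := μ) hK
  rwa [IntegrableOn, Measure.restrict_eq_self_of_ae_mem h] at this

instance {n : ℕ} (μ : StateSpace n) : IsFiniteMeasure μ.1 := μ.2.1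

instance {n : ℕ} (ρ : LiftedSpace n) : IsProbabilityMeasure ρ.1 := ρ.2.1

theorem StateSpace.integrable {n : ℕ} (μ : StateSpace n) {φ : Rn n → ℝ} (hφ : Continuous φ) :
    Integrable φ μ.1 := by
  obtain ⟨K, hK, hμ⟩ := μ.2.2
  exact integrable_of_carriedBy hK hμ hφ

theorem LiftedSpace.integrable {n : ℕ} (ρ : LiftedSpace n) {φ : Rn n × ℝ → ℝ}
    (hφ : Continuous φ) : Integrable φ ρ.1 := by
  obtain ⟨K, hK, -, hρ⟩ := ρ.2.2
  exact integrable_of_carriedBy hK hρ hφ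

theorem krDist_le_of_KRLe {n : ℕ} {μ ν : StateSpace n} {a : ℝ} (h : KRLe μ.1 ν.1 a) :
    krDist μ ν ≤ a := by
  refine csSup_le ⟨0, fun _ => 0, LipschitzWith.const' 0, by simp, by simp⟩ ?_
  rintro r ⟨φ, hφ, hb, rfl⟩
  refine h φ ⟨hb, fun x y => ?_⟩
  have := hφ.dist_le_mul x y
  rwa [Real.dist_eq, dist_eq_norm] at this

theorem krDist_self {n : ℕ} (μ : StateSpace n) : krDist μ μ = 0 := by
  unfold krDist
  have : {r : ℝ | ∃ φ : Rn n → ℝ, LipschitzWith 1 φ ∧ (∀ x, |φ x| ≤ 1) ∧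
      r = ∫ x, φ x ∂μ.1 - ∫ x, φ x ∂μ.1} = {0} := by
    ext r
    simp only [sub_self, mem_ofPred_eq, mem_singleton_iff]
    exact ⟨fun ⟨_, _, _, h⟩ => h,
      fun h => ⟨fun _ => 0, LipschitzWith.const' 0, by simp, h⟩⟩
  rw [this, csSup_singleton]

/-- If the exponential moments `∫ exp (k w) dν` grow at most like `exp (k α + β)` relative to those
of `ν₀`, then the essential supremum of `w` grows at most by `α`. -/
theorem ae_le_add_of_integral_exp_le {X : Type*} [MeasurableSpace X] {ν₀ ν : Measure X}
    [IsFiniteMeasure ν₀] [IsFiniteMeasure ν] {w : X → ℝ} {w₀ α β : ℝ}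
    (hi₀ : ∀ k : ℕ, Integrable (fun x => Real.exp (k * w x)) ν₀)
    (hi : ∀ k : ℕ, Integrable (fun x => Real.exp (k * w x)) ν)
    (h : ∀ k : ℕ, ∫ x, Real.exp (k * w x) ∂ν
      ≤ (∫ x, Real.exp (k * w x) ∂ν₀) * Real.exp (k * α + β))
    (h₀ : ∀ᵐ x ∂ν₀, w x ≤ w₀) : ∀ᵐ x ∂ν, w x ≤ w₀ + α := by
  have key : ∀ j : ℕ, ∀ᵐ x ∂ν, w x < w₀ + α + 1 / ((j : ℝ) + 1) := by
    intro j
    set ε : ℝ := 1 / ((j : ℝ) + 1) with hε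
    have hε0 : 0 < ε := by positivity
    have hbound : ∀ k : ℕ, ν.real {x | w₀ + α + ε ≤ w x}
        ≤ ν₀.real univ * Real.exp β * Real.exp (-ε) ^ k := by
      intro k
      have h1 := mul_meas_ge_le_integral_of_nonneg (μ := ν)
        (Eventually.of_forall fun x => (Real.exp_pos (k * w x)).le) (hi k)
        (Real.exp (k * (w₀ + α + ε)))
      have h2 : ∫ x, Real.exp (k * w x) ∂ν₀ ≤ ν₀.real univ * Real.exp (k * w₀) := by
        calc _ ≤ ∫ _, Real.exp (k * w₀) ∂ν₀ := by
              refine integral_mono_ae (hi₀ k) (integrable_const _) ?_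
              filter_upwards [h₀] with x hx
              gcongr
          _ = _ := by simp
      have h3 : ν.real {x | w₀ + α + ε ≤ w x}
          ≤ ν.real {x | Real.exp (k * (w₀ + α + ε)) ≤ Real.exp (k * w x)} := by
        refine measureReal_mono fun x hx => ?_
        simp only [mem_ofPred_eq] at hx ⊢
        gcongr
      have h4 : Real.exp (k * (w₀ + α + ε)) * ν.real {x | w₀ + α + ε ≤ w x}
          ≤ ν₀.real univ * Real.exp (k * w₀) * Real.exp (k * α + β) := by
        calc _ ≤ _ := mul_le_mul_of_nonneg_left h3 (Real.exp_pos _).le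
          _ ≤ _ := h1
          _ ≤ _ := h k
          _ ≤ _ := by gcongr
      rw [← Real.exp_nat_mul]
      have h5 : ν₀.real univ * Real.exp (k * w₀) * Real.exp (k * α + β)
          = Real.exp (k * (w₀ + α + ε)) * (ν₀.real univ * Real.exp β * Real.exp (k * -ε)) := by
        have : Real.exp (k * w₀) * Real.exp (k * α + β)
            = Real.exp (k * (w₀ + α + ε)) * Real.exp β * Real.exp (k * -ε) := by
          rw [← Real.exp_add, ← Real.exp_add, ← Real.exp_add]; ring_nf
        linear_combination ν₀.real univ * this
      rw [h5] at h4
      exact le_of_mul_le_mul_left h4 (Real.exp_pos _)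
    have hlim : Tendsto (fun k : ℕ => ν₀.real univ * Real.exp β * Real.exp (-ε) ^ k) atTop
        (𝓝 (ν₀.real univ * Real.exp β * 0)) :=
      (tendsto_pow_atTop_nhds_zero_of_lt_one (Real.exp_pos _).le (by simpa using hε0)).const_mul _
    have h0 := ge_of_tendsto hlim (Eventually.of_forall hbound)
    rw [mul_zero] at h0
    have h1 : ν {x | w₀ + α + ε ≤ w x} = 0 := by
      rw [← measureReal_eq_zero_iff]
      exact le_antisymm h0 measureReal_nonneg
    rw [ae_iff]
    simpa using h1
  filter_upwards [ae_all_iff.2 key] with x hx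
  refine le_of_tendsto_of_tendsto' tendsto_const_nhds
    (tendsto_one_div_add_atTop_nhds_zero_nat.const_add (w₀ + α)) (fun j => (hx j).le) |>.trans ?_
  simp

/-! ### Truncation -/

/-- The projection of `ℝ` onto `[a, b]`. -/
noncomputable def clamp (a b y : ℝ) : ℝ := max a (min b y)

theorem clamp_mem {a b : ℝ} (h : a ≤ b) (y : ℝ) : clamp a b y ∈ Icc a b := by
  unfold clamp; exact ⟨le_max_left _ _, max_le h (min_le_left _ _)⟩

theorem clamp_eq {a b y : ℝ} (h : y ∈ Icc a b) : clamp a b y = y := by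
  unfold clamp; rw [min_eq_right h.2, max_eq_right h.1]

theorem abs_clamp_sub_le (a b y z : ℝ) : |clamp a b y - clamp a b z| ≤ |y - z| := by
  unfold clamp
  grind

/-- The cube of half-width `R` around the origin. -/
def cube (n : ℕ) (R : ℝ) : Set (Rn n) := {x | ∀ i, x i ∈ Icc (-R) R}

/-- The coordinatewise projection onto the cube, a `1`-Lipschitz retraction. -/
noncomputable def cubeProj {n : ℕ} (R : ℝ) (x : Rn n) : Rn n :=
  WithLp.toLp 2 fun i => clamp (-R) R (x i)

theorem isCompact_cube (n : ℕ) (R : ℝ) : IsCompact (cube n R) := by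
  have h : IsCompact (Set.pi univ fun _ : Fin n => Icc (-R) R) :=
    isCompact_univ_pi fun _ => isCompact_Icc
  convert h.image (PiLp.continuous_toLp 2 fun _ : Fin n => ℝ)
  ext x
  simp only [cube, mem_ofPred_eq, mem_image, mem_univ_pi]
  exact ⟨fun hx => ⟨_, hx, rfl⟩, by rintro ⟨y, hy, rfl⟩; exact hy⟩

theorem mem_cube_of_norm_le {n : ℕ} {R : ℝ} {x : Rn n} (h : ‖x‖ ≤ R) : x ∈ cube n R := fun i =>
  abs_le.1 ((PiLp.norm_apply_le x i).trans h)

theorem cubeProj_mem {n : ℕ} {R : ℝ} (hR : 0 ≤ R) (x : Rn n) : cubeProj R x ∈ cube n R :=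
  fun _ => clamp_mem (by linarith) _

theorem cubeProj_eq {n : ℕ} {R : ℝ} {x : Rn n} (h : x ∈ cube n R) : cubeProj R x = x := by
  ext i
  exact clamp_eq (h i)

theorem norm_cubeProj_sub_le {n : ℕ} (R : ℝ) (x y : Rn n) :
    ‖cubeProj R x - cubeProj R y‖ ≤ ‖x - y‖ := by
  rw [EuclideanSpace.norm_eq, EuclideanSpace.norm_eq]
  refine Real.sqrt_le_sqrt (Finset.sum_le_sum fun i _ => ?_)
  rw [PiLp.sub_apply, PiLp.sub_apply, Real.norm_eq_abs, Real.norm_eq_abs]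
  exact pow_le_pow_left₀ (abs_nonneg _) (abs_clamp_sub_le _ _ _ _) 2

@[fun_prop]
theorem continuous_cubeProj {n : ℕ} (R : ℝ) : Continuous (cubeProj (n := n) R) :=
  (LipschitzWith.of_dist_le_mul (K := 1) fun x y => by
    simpa [dist_eq_norm] using norm_cubeProj_sub_le R x y).continuous

@[fun_prop]
theorem continuous_clamp (a b : ℝ) : Continuous (clamp a b) := by
  unfold clamp; fun_prop

/-! ### Regularity of the coefficients -/

section

variable {m n : ℕ} {T : ℝ} {U : Set (Rn m)} {F : NonlocalField m n} {G : NonlocalDensity m n}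

theorem RegularData.continuous_space (hFG : RegularData T U F G) {t : ℝ} (ht : t ∈ Icc 0 T)
    {u : Rn m} (hu : u ∈ U) (μ : StateSpace n) :
    Continuous (F t u μ) ∧ Continuous (G t u μ) := by
  obtain ⟨K, hK, hμ⟩ := μ.2.2
  have key : ∀ x₀ : Rn n, ∃ M : ℝ, 0 < M ∧ ∀ x ∈ closedBall x₀ 1,
      ‖F t u μ x - F t u μ x₀‖ ≤ M * ‖x - x₀‖ ∧ |G t u μ x - G t u μ x₀| ≤ M * ‖x - x₀‖ := by
    intro x₀
    obtain ⟨M, hM, h⟩ := hFG.lipschitz (K ∪ closedBall x₀ 1) (hK.union (isCompact_closedBall _ _))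
    refine ⟨M, hM, fun x hx => ?_⟩
    have hc : CarriedBy μ.1 (K ∪ closedBall x₀ 1) :=
      measure_mono_null (compl_subset_compl.2 subset_union_left) hμ
    have := h t ht u hu μ μ hc hc x (Or.inr hx) x₀ (Or.inr (by simp))
    simpa [krDist_self] using this
  constructor
  · refine continuous_iff_continuousAt.2 fun x₀ => ?_
    obtain ⟨M, hM, h⟩ := key x₀
    refine continuousAt_of_locally_lipschitz one_pos M fun x hx => ?_
    rw [dist_eq_norm, dist_eq_norm]
    exact (h x (mem_closedBall.2 hx.le)).1
  · refine continuous_iff_continuousAt.2 fun x₀ => ?_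
    obtain ⟨M, hM, h⟩ := key x₀
    refine continuousAt_of_locally_lipschitz one_pos M fun x hx => ?_
    rw [dist_eq_norm, dist_eq_norm]
    exact (h x (mem_closedBall.2 hx.le)).2

/-! ### The barycentric projection of a lifted solution -/

theorem fderiv_snd_mul {φ : Rn n → ℝ} (hφ : ContDiff ℝ 1 φ) (z d : Rn n × ℝ) :
    fderiv ℝ (fun z : Rn n × ℝ => z.2 * φ z.1) z d
      = z.2 * fderiv ℝ φ z.1 d.1 + d.2 * φ z.1 := by
  have h1 : HasFDerivAt (fun z : Rn n × ℝ => φ z.1)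
      ((fderiv ℝ φ z.1).comp (ContinuousLinearMap.fst ℝ (Rn n) ℝ)) z :=
    (hφ.differentiable one_ne_zero z.1).hasFDerivAt.comp z hasFDerivAt_fst
  have h2 : HasFDerivAt (fun z : Rn n × ℝ => z.2 * φ z.1) _ z :=
    (hasFDerivAt_snd (𝕜 := ℝ) (p := z)).mul h1
  rw [h2.fderiv]
  simp [mul_comm]

/-- The barycentric projection of a solution of the lifted continuity equation solves the balance
law. -/
theorem SolvesLifted.solvesBalance (hFG : RegularData T U F G) {ϑ : StateSpace n} {u : ℝ → Rn m}
    (hu : ∀ᵐ t ∂(volume.restrict (Icc 0 T)), u t ∈ U) {ρ : ℝ → LiftedSpace n}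
    (h : SolvesLifted T F G ϑ u ρ) : SolvesBalance T F G ϑ u (fun t => bary (ρ t)) := by
  have hC : ∀ φ : Rn n → ℝ, ContDiff ℝ 1 φ →
      ContDiff ℝ 1 (fun z : Rn n × ℝ => z.2 * φ z.1) := fun φ hφ =>
    contDiff_snd.mul (hφ.comp contDiff_fst)
  have hI : ∀ φ : Rn n → ℝ, ContDiff ℝ 1 φ → (fun t => ∫ x, φ x ∂(bary (ρ t)).1)
      = fun t => ∫ z, z.2 * φ z.1 ∂(ρ t).1 := fun φ hφ => by
    ext t; exact integral_bary (ρ t) hφ.continuous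
  refine ⟨?_, fun φ hφ => ?_, fun φ hφ => ?_⟩
  · refine Subtype.ext (measure_eq_of_forall_BLBound fun φ hφ => ?_)
    rw [integral_bary _ hφ.continuous, h.initial, Measure.prod_dirac,
      integral_map (by fun_prop)]
    · simp
    · have := hφ.continuous
      exact (by fun_prop : Continuous fun z : Rn n × ℝ => z.2 * φ z.1).aestronglyMeasurable
  · rw [hI φ hφ]
    exact h.absCont _ (hC φ hφ)
  · rw [hI φ hφ]
    filter_upwards [h.weak _ (hC φ hφ), hu, ae_restrict_mem measurableSet_Icc] with t ht hut htm
    convert ht using 1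
    obtain ⟨hF, hG⟩ := hFG.continuous_space htm hut (bary (ρ t))
    have hφ' := hφ.continuous_fderiv one_ne_zero
    have hφc := hφ.continuous
    rw [integral_bary _ (by fun_prop)]
    congr 1
    ext z
    rw [fderiv_snd_mul hφ]
    simp only [liftedField]
    ring

/-! ### A priori bounds -/

/-- If `Dφ · F + G φ ≤ K φ`, the integral of `φ` grows at most exponentially at rate `K`. -/
theorem SolvesBalance.integral_le (hFG : RegularData T U F G) {ϑ : StateSpace n} {u : ℝ → Rn m}
    (hu : ∀ᵐ t ∂(volume.restrict (Icc 0 T)), u t ∈ U) {μ : ℝ → StateSpace n}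
    (h : SolvesBalance T F G ϑ u μ) {φ : Rn n → ℝ} (hφ : ContDiff ℝ 1 φ) {K : ℝ}
    (hK : ∀ t ∈ Icc 0 T, u t ∈ U → ∀ x,
      fderiv ℝ φ x (F t (u t) (μ t) x) + G t (u t) (μ t) x * φ x ≤ K * φ x)
    {t : ℝ} (ht : t ∈ Icc 0 T) :
    ∫ x, φ x ∂(μ t).1 ≤ (∫ x, φ x ∂ϑ.1) * Real.exp (K * t) := by
  have := le_mul_exp_of_ae_hasDerivAt_le (K := K) (h.absCont φ hφ) (h.weak φ hφ) (by
    filter_upwards [hu, ae_restrict_mem measurableSet_Icc] with s hus hs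
    obtain ⟨hF, hG⟩ := hFG.continuous_space hs hus (μ s)
    have hφ' := hφ.continuous_fderiv one_ne_zero
    have hφc := hφ.continuous
    rw [← integral_const_mul]
    exact integral_mono ((μ s).integrable (by fun_prop)) ((μ s).integrable (by fun_prop))
      (hK s hs hus)) ht
  rwa [h.initial] at this

/-- If `Dφ · 𝐅 ≤ K φ`, the integral of `φ` grows at most exponentially at rate `K`. -/
theorem SolvesLifted.integral_le (hFG : RegularData T U F G) {ϑ : StateSpace n} {u : ℝ → Rn m}
    (hu : ∀ᵐ t ∂(volume.restrict (Icc 0 T)), u t ∈ U) {ρ : ℝ → LiftedSpace n}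
    (h : SolvesLifted T F G ϑ u ρ) {φ : Rn n × ℝ → ℝ} (hφ : ContDiff ℝ 1 φ) {K : ℝ}
    (hK : ∀ t ∈ Icc 0 T, u t ∈ U → ∀ z,
      fderiv ℝ φ z (liftedField F G t (u t) (ρ t) z) ≤ K * φ z)
    {t : ℝ} (ht : t ∈ Icc 0 T) :
    ∫ z, φ z ∂(ρ t).1 ≤ (∫ z, φ z ∂(ρ 0).1) * Real.exp (K * t) := by
  refine le_mul_exp_of_ae_hasDerivAt_le (K := K) (h.absCont φ hφ) (h.weak φ hφ) ?_ ht
  filter_upwards [hu, ae_restrict_mem measurableSet_Icc] with s hus hs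
  obtain ⟨hF, hG⟩ := hFG.continuous_space hs hus (bary (ρ s))
  have hφ' := hφ.continuous_fderiv one_ne_zero
  have hφc := hφ.continuous
  rw [← integral_const_mul]
  refine integral_mono ((ρ s).integrable ?_) ((ρ s).integrable (by fun_prop)) (hK s hs hus)
  unfold liftedField
  fun_prop

theorem contDiff_sqrt_one_add_norm_sq : ContDiff ℝ 1 fun x : Rn n => √(1 + ‖x‖ ^ 2) :=
  (contDiff_const.add (contDiff_norm_sq ℝ)).sqrt fun x => by positivity

theorem abs_fderiv_sqrt_one_add_norm_sq_le (x d : Rn n) :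
    |fderiv ℝ (fun x : Rn n => √(1 + ‖x‖ ^ 2)) x d| ≤ ‖d‖ := by
  have hpos : 0 < √(1 + ‖x‖ ^ 2) := by positivity
  have h1 : HasFDerivAt (fun x : Rn n => 1 + ‖x‖ ^ 2) (2 • innerSL ℝ x) x :=
    (hasStrictFDerivAt_norm_sq x).hasFDerivAt.const_add 1
  rw [(h1.sqrt (by positivity)).fderiv]
  simp only [nsmul_eq_mul, smul_apply, smul_eq_mul]
  have h2 : ((2 : ℕ) : ℝ) * innerSL ℝ x d = 2 * inner ℝ x d := by simp
  rw [h2, abs_mul, abs_of_nonneg (by positivity), abs_mul, abs_two]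
  have h3 := abs_real_inner_le_norm x d
  have h4 : ‖x‖ ≤ √(1 + ‖x‖ ^ 2) := Real.le_sqrt_of_sq_le (by linarith)
  rw [one_div, inv_mul_le_iff₀ (by positivity)]
  have := mul_le_mul_of_nonneg_right h4 (norm_nonneg d)
  linarith

theorem fderiv_exp_mul {E : Type*} [NormedAddCommGroup E] [NormedSpace ℝ E] {w : E → ℝ}
    (hw : ContDiff ℝ 1 w) (k : ℝ) (x d : E) :
    fderiv ℝ (fun x => Real.exp (k * w x)) x d = Real.exp (k * w x) * (k * fderiv ℝ w x d) := by
  have := (((hw.differentiable one_ne_zero x).hasFDerivAt).const_mul k).exp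
  rw [this.fderiv]
  simp

/-- The masses of all solutions of the balance law are bounded by `exp (C T)`. -/
theorem SolvesBalance.mass_le (hFG : RegularData T U F G) {C : ℝ}
    (hC : ∀ t ∈ Icc 0 T, ∀ u ∈ U, ∀ (μ : StateSpace n) (x : Rn n),
      ‖F t u μ x‖ ≤ C * (1 + μ.1.real univ) ∧ |G t u μ x| ≤ C) (hC0 : 0 < C)
    {ϑ : StateSpace n} (hϑ : IsProbabilityMeasure ϑ.1) {u : ℝ → Rn m}
    (hu : ∀ᵐ t ∂(volume.restrict (Icc 0 T)), u t ∈ U) {μ : ℝ → StateSpace n}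
    (h : SolvesBalance T F G ϑ u μ) {t : ℝ} (ht : t ∈ Icc 0 T) :
    (μ t).1.real univ ≤ Real.exp (C * T) := by
  have := h.integral_le hFG hu (φ := fun _ => 1) contDiff_const (K := C) (fun s hs hus x => by
    simpa using (abs_le.1 (hC s hs _ hus (μ s) x).2).2) ht
  simp only [integral_const, smul_eq_mul, mul_one, probReal_univ, one_mul] at this
  exact this.trans (by gcongr; exact ht.2)

/-- The supports of all solutions of the balance law stay in a common bounded set. -/
theorem SolvesBalance.exists_support_bound (hFG : RegularData T U F G) (ϑ : StateSpace n)
    (hϑ : IsProbabilityMeasure ϑ.1) :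
    ∃ R : ℝ, 0 ≤ R ∧ ∀ u : ℝ → Rn m, (∀ᵐ t ∂(volume.restrict (Icc 0 T)), u t ∈ U) →
      ∀ μ, SolvesBalance T F G ϑ u μ → ∀ t ∈ Icc 0 T, ∀ᵐ x ∂(μ t).1, ‖x‖ ≤ R := by
  obtain ⟨C, hC0, hC⟩ := hFG.sublinear
  obtain ⟨K, hK, hϑK⟩ := ϑ.2.2
  obtain ⟨R₀, hR₀⟩ := hK.isBounded.exists_norm_le
  have hϑK' : ∀ᵐ x ∂ϑ.1, x ∈ K := hϑK
  set V := C * (1 + Real.exp (C * T)) with hV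
  have hV0 : 0 ≤ V := by positivity
  set w : Rn n → ℝ := fun x => √(1 + ‖x‖ ^ 2)
  have hw : ContDiff ℝ 1 w := contDiff_sqrt_one_add_norm_sq
  refine ⟨√(1 + R₀ ^ 2) + V * |T|, by positivity, fun u hu μ hμ t ht => ?_⟩
  have hc : ∀ k : ℕ, ContDiff ℝ 1 fun x => Real.exp (k * w x) := fun k =>
    (contDiff_const.mul hw).exp
  have key := ae_le_add_of_integral_exp_le (ν₀ := ϑ.1) (ν := (μ t).1) (w := w)
    (w₀ := √(1 + R₀ ^ 2)) (α := V * t) (β := C * t)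
    (fun k => ϑ.integrable (hc k).continuous) (fun k => (μ t).integrable (hc k).continuous)
    (fun k => by
      have := hμ.integral_le hFG hu (hc k) (K := k * V + C) (fun s hs hus x => by
        rw [fderiv_exp_mul hw]
        have h1 := abs_le.1 (abs_fderiv_sqrt_one_add_norm_sq_le x (F s (u s) (μ s) x))
        have h2 : ‖F s (u s) (μ s) x‖ ≤ V := (hC s hs _ hus (μ s) x).1.trans (by
          rw [hV]; gcongr; exact hμ.mass_le hFG hC hC0 hϑ hu hs)
        have h3 := (abs_le.1 (hC s hs _ hus (μ s) x).2).2
        have h4 : (k : ℝ) * fderiv ℝ w x (F s (u s) (μ s) x) ≤ k * V := by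
          gcongr
          exact h1.2.trans h2
        have h5 := mul_le_mul_of_nonneg_left (add_le_add h4 h3) (Real.exp_pos (k * w x)).le
        linarith) ht
      rwa [show ((k : ℝ) * V + C) * t = k * (V * t) + C * t by ring] at this)
    (by
      filter_upwards [hϑK'] with x hx
      have := hR₀ x hx
      exact Real.sqrt_le_sqrt (by gcongr))
  filter_upwards [key] with x hx
  have h4 : ‖x‖ ≤ w x := Real.le_sqrt_of_sq_le (by linarith)
  have h5 : V * t ≤ V * |T| := by gcongr; exact ht.2.trans (le_abs_self T)
  linarith

/-- The supports of all solutions of the lifted equation stay in a common bounded set. -/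
theorem SolvesLifted.exists_support_bound (hFG : RegularData T U F G) (ϑ : StateSpace n)
    (hϑ : IsProbabilityMeasure ϑ.1) :
    ∃ R : ℝ, 0 ≤ R ∧ ∀ u : ℝ → Rn m, (∀ᵐ t ∂(volume.restrict (Icc 0 T)), u t ∈ U) →
      ∀ ρ, SolvesLifted T F G ϑ u ρ → ∀ t ∈ Icc 0 T, ∀ᵐ z ∂(ρ t).1, ‖z.1‖ ≤ R ∧ |z.2| ≤ R := by
  obtain ⟨C, hC0, hC⟩ := hFG.sublinear
  obtain ⟨K, hK, hϑK⟩ := ϑ.2.2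
  obtain ⟨R₀, hR₀⟩ := hK.isBounded.exists_norm_le
  have hϑK' : ∀ᵐ x ∂ϑ.1, x ∈ K := hϑK
  set V := C * (1 + Real.exp (C * T)) with hV
  have hV0 : 0 ≤ V := by positivity
  set w : Rn n × ℝ → ℝ := fun z => √(1 + ‖z.1‖ ^ 2)
  set q : Rn n × ℝ → ℝ := fun z => Real.log (1 + z.2 ^ 2)
  have hw₁ : ContDiff ℝ 1 fun x : Rn n => √(1 + ‖x‖ ^ 2) := contDiff_sqrt_one_add_norm_sq
  have hw : ContDiff ℝ 1 w := hw₁.comp contDiff_fst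
  have hq : ContDiff ℝ 1 q :=
    (contDiff_const.add (contDiff_snd.pow 2)).log fun z => by positivity
  have hw' : ∀ z d, |fderiv ℝ w z d| ≤ ‖d.1‖ := fun z d => by
    have : HasFDerivAt w ((fderiv ℝ (fun x : Rn n => √(1 + ‖x‖ ^ 2)) z.1).comp
        (ContinuousLinearMap.fst ℝ (Rn n) ℝ)) z :=
      (hw₁.differentiable one_ne_zero z.1).hasFDerivAt.comp z hasFDerivAt_fst
    rw [this.fderiv]
    exact abs_fderiv_sqrt_one_add_norm_sq_le z.1 d.1
  have hq' : ∀ z d, fderiv ℝ q z d = 2 * z.2 * d.2 / (1 + z.2 ^ 2) := fun z d => by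
    have h1 := (((hasFDerivAt_snd (𝕜 := ℝ) (p := z)).pow 2).const_add 1).log
      (by positivity : (1 + z.2 ^ 2) ≠ 0)
    rw [h1.fderiv]
    simp
    ring
  set b := Real.log 2 + 2 * C * |T| with hb
  refine ⟨√(1 + R₀ ^ 2) + V * |T| + Real.exp b, by positivity, fun u hu ρ hρ t ht => ?_⟩
  have hρ₀ : ∀ᵐ z ∂(ρ 0).1, z.1 ∈ K ∧ z.2 = 1 := by
    rw [hρ.initial, Measure.prod_dirac, ae_map_iff (by fun_prop)]
    · filter_upwards [hϑK'] with x hx using ⟨hx, rfl⟩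
    · exact (measurable_fst hK.isClosed.measurableSet).inter
        (measurableSet_eq_fun measurable_snd measurable_const)
  have hmass : ∀ s ∈ Icc 0 T, (bary (ρ s)).1.real univ ≤ Real.exp (C * T) := fun s hs =>
    (hρ.solvesBalance hFG hu).mass_le hFG hC hC0 hϑ hu hs
  have hcw : ∀ k : ℕ, ContDiff ℝ 1 fun x => Real.exp (k * w x) := fun k =>
    (contDiff_const.mul hw).exp
  have hcq : ∀ k : ℕ, ContDiff ℝ 1 fun x => Real.exp (k * q x) := fun k =>
    (contDiff_const.mul hq).exp
  have key₁ := ae_le_add_of_integral_exp_le (ν₀ := (ρ 0).1) (ν := (ρ t).1) (w := w)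
    (w₀ := √(1 + R₀ ^ 2)) (α := V * t) (β := 0)
    (fun k => (ρ 0).integrable (hcw k).continuous) (fun k => (ρ t).integrable (hcw k).continuous)
    (fun k => by
      have := hρ.integral_le hFG hu (hcw k) (K := k * V) (fun s hs hus z => by
        rw [fderiv_exp_mul hw]
        have h1 := abs_le.1 (hw' z (liftedField F G s (u s) (ρ s) z))
        have h2 : ‖F s (u s) (bary (ρ s)) z.1‖ ≤ V := (hC s hs _ hus _ z.1).1.trans (by
          rw [hV]; gcongr; exact hmass s hs)
        have h4 : (k : ℝ) * fderiv ℝ w z (liftedField F G s (u s) (ρ s) z) ≤ k * V := by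
          gcongr
          exact h1.2.trans h2
        have h5 := mul_le_mul_of_nonneg_left h4 (Real.exp_pos (k * w z)).le
        linarith) ht
      rwa [show (k : ℝ) * V * t = k * (V * t) + 0 by ring] at this)
    (by
      filter_upwards [hρ₀] with z hz
      have := hR₀ z.1 hz.1
      exact Real.sqrt_le_sqrt (by gcongr))
  have key₂ := ae_le_add_of_integral_exp_le (ν₀ := (ρ 0).1) (ν := (ρ t).1) (w := q)
    (w₀ := Real.log 2) (α := 2 * C * t) (β := 0)
    (fun k => (ρ 0).integrable (hcq k).continuous) (fun k => (ρ t).integrable (hcq k).continuous)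
    (fun k => by
      have := hρ.integral_le hFG hu (hcq k) (K := k * (2 * C)) (fun s hs hus z => by
        rw [fderiv_exp_mul hq, hq']
        have h3 := (abs_le.1 (hC s hs _ hus (bary (ρ s)) z.1).2).2
        have h2 : 2 * z.2 * (liftedField F G s (u s) (ρ s) z).2 / (1 + z.2 ^ 2) ≤ 2 * C := by
          rw [div_le_iff₀ (by positivity)]
          simp only [liftedField]
          nlinarith [mul_nonneg (sq_nonneg z.2) (sub_nonneg.2 h3)]
        have h4 : (k : ℝ) * (2 * z.2 * (liftedField F G s (u s) (ρ s) z).2 / (1 + z.2 ^ 2))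
            ≤ k * (2 * C) := by gcongr
        have h5 := mul_le_mul_of_nonneg_left h4 (Real.exp_pos (k * q z)).le
        linarith) ht
      rwa [show (k : ℝ) * (2 * C) * t = k * (2 * C * t) + 0 by ring] at this)
    (by
      filter_upwards [hρ₀] with z hz
      simp only [q, hz.2]
      norm_num)
  filter_upwards [key₁, key₂] with z hz₁ hz₂
  have h4 : ‖z.1‖ ≤ w z := Real.le_sqrt_of_sq_le (by linarith)
  have hT : t ≤ |T| := ht.2.trans (le_abs_self T)
  have h5 : V * t ≤ V * |T| := by gcongr
  have h6 : |z.2| ≤ Real.exp b := by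
    have h7 : q z ≤ b := hz₂.trans (by rw [hb]; gcongr)
    rw [Real.log_le_iff_le_exp (by positivity)] at h7
    have h8 : |z.2| ≤ 1 + z.2 ^ 2 := by
      rw [← sq_abs]; nlinarith [sq_nonneg (|z.2| - 1), abs_nonneg z.2]
    linarith
  have h9 := Real.exp_pos b
  have h10 : 0 ≤ √(1 + R₀ ^ 2) + V * |T| := by positivity
  constructor <;> linarith

end

/-! ### Uniqueness -/

section

variable {m n : ℕ} {T : ℝ} {U : Set (Rn m)} {F : NonlocalField m n} {G : NonlocalDensity m n}

/-- A solution of the nonlocal balance law supported in a cube is a weak solution for the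
coefficients truncated outside the cube, which are bounded and Lipschitz on the whole space. -/
theorem SolvesBalance.weakCurve {C : ℝ}
    (hC : ∀ t ∈ Icc 0 T, ∀ u ∈ U, ∀ (μ : StateSpace n) (x : Rn n),
      ‖F t u μ x‖ ≤ C * (1 + μ.1.real univ) ∧ |G t u μ x| ≤ C) (hC0 : 0 < C)
    {ϑ : StateSpace n} {u : ℝ → Rn m}
    (hu : ∀ᵐ t ∂(volume.restrict (Icc 0 T)), u t ∈ U) {μ : ℝ → StateSpace n}
    (h : SolvesBalance T F G ϑ u μ) {R M₀ M : ℝ} (hR : 0 ≤ R) (hM₀ : 0 ≤ M₀)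
    (hμR : ∀ t ∈ Icc 0 T, CarriedBy (μ t).1 (cube n R))
    (hmass : ∀ t ∈ Icc 0 T, (μ t).1.real univ ≤ M₀)
    (hM : ∀ t ∈ Icc 0 T, ∀ u ∈ U, ∀ μ μ' : StateSpace n, CarriedBy μ.1 (cube n R) →
      CarriedBy μ'.1 (cube n R) → ∀ x ∈ cube n R, ∀ x' ∈ cube n R,
        ‖F t u μ x - F t u μ' x'‖ ≤ M * (‖x - x'‖ + krDist μ μ') ∧
        |G t u μ x - G t u μ' x'| ≤ M * (‖x - x'‖ + krDist μ μ')) (hM0 : 0 < M) :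
    WeakCurve T M₀ (C * (1 + M₀)) M (fun t x => F t (u t) (μ t) (cubeProj R x))
      (fun t x => G t (u t) (μ t) (cubeProj R x)) (fun t => (μ t).1) where
  finite t _ := inferInstance
  mass := hmass
  absCont := h.absCont
  weak f hf := by
    filter_upwards [h.weak f hf, ae_restrict_mem measurableSet_Icc] with t ht htm
    convert ht using 1
    refine integral_congr_ae ?_
    have : ∀ᵐ x ∂(μ t).1, x ∈ cube n R := hμR t htm
    filter_upwards [this] with x hx
    simp only [cubeProj_eq hx]
  bound := by
    filter_upwards [hu, ae_restrict_mem measurableSet_Icc] with t hut htm x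
    have h1 := hC t htm _ hut (μ t) (cubeProj R x)
    refine ⟨h1.1.trans ?_, h1.2.trans ?_⟩
    · gcongr
      exact hmass t htm
    · exact le_mul_of_one_le_right hC0.le (by linarith)
  lip := by
    filter_upwards [hu, ae_restrict_mem measurableSet_Icc] with t hut htm x y
    have h1 := hM t htm _ hut (μ t) (μ t) (hμR t htm) (hμR t htm) _ (cubeProj_mem hR x) _
      (cubeProj_mem hR y)
    rw [krDist_self, add_zero] at h1
    have h2 : M * ‖cubeProj R x - cubeProj R y‖ ≤ M * ‖x - y‖ := by
      gcongr
      exact norm_cubeProj_sub_le R x y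
    exact ⟨h1.1.trans h2, h1.2.trans h2⟩

theorem SolvesBalance.eqOn (hFG : RegularData T U F G) {ϑ : StateSpace n}
    (hϑ : IsProbabilityMeasure ϑ.1) {u : ℝ → Rn m}
    (hu : ∀ᵐ t ∂(volume.restrict (Icc 0 T)), u t ∈ U) {μ μ' : ℝ → StateSpace n}
    (h : SolvesBalance T F G ϑ u μ) (h' : SolvesBalance T F G ϑ u μ') : EqOn μ μ' (Icc 0 T) := by
  intro t ht
  obtain ⟨C, hC0, hC⟩ := hFG.sublinear
  obtain ⟨R, hR, hbound⟩ := SolvesBalance.exists_support_bound hFG ϑ hϑ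
  obtain ⟨M, hM0, hM⟩ := hFG.lipschitz (cube n R) (isCompact_cube n R)
  have hcarr : ∀ ν, SolvesBalance T F G ϑ u ν → ∀ t ∈ Icc 0 T, CarriedBy (ν t).1 (cube n R) :=
    fun ν hν t ht => by
      have : ∀ᵐ x ∂(ν t).1, x ∈ cube n R := by
        filter_upwards [hbound u hu ν hν t ht] with x hx using mem_cube_of_norm_le hx
      exact this
  have hw : ∀ ν, SolvesBalance T F G ϑ u ν → WeakCurve T (Real.exp (C * T))
      (C * (1 + Real.exp (C * T))) M (fun t x => F t (u t) (ν t) (cubeProj R x))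
      (fun t x => G t (u t) (ν t) (cubeProj R x)) (fun t => (ν t).1) := fun ν hν =>
    hν.weakCurve hC hC0 hu hR (Real.exp_pos _).le (hcarr ν hν)
      (fun s hs => hν.mass_le hFG hC hC0 hϑ hu hs) hM hM0
  refine Subtype.ext ((hw μ h).eq_of_initial_eq (hw μ' h') (M := M) (by positivity) (by positivity)
    hM0.le hM0.le ?_ (by rw [h.initial, h'.initial]) ht)
  filter_upwards [hu, ae_restrict_mem measurableSet_Icc] with s hus hs a ha x
  have h1 := hM s hs _ hus _ _ (hcarr μ h s hs) (hcarr μ' h' s hs) _ (cubeProj_mem hR x) _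
    (cubeProj_mem hR x)
  rw [sub_self, norm_zero, zero_add] at h1
  have h2 : M * krDist (μ s) (μ' s) ≤ M * a := by
    gcongr
    exact krDist_le_of_KRLe ha
  exact ⟨h1.1.trans h2, h1.2.trans h2⟩

/-- Two solutions of the lifted equation have the same barycentric projection, hence they solve
the same linear continuity equation. -/
theorem SolvesLifted.eqOn (hFG : RegularData T U F G) {ϑ : StateSpace n}
    (hϑ : IsProbabilityMeasure ϑ.1) {u : ℝ → Rn m}
    (hu : ∀ᵐ t ∂(volume.restrict (Icc 0 T)), u t ∈ U) {ρ ρ' : ℝ → LiftedSpace n}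
    (h : SolvesLifted T F G ϑ u ρ) (h' : SolvesLifted T F G ϑ u ρ') : EqOn ρ ρ' (Icc 0 T) := by
  intro t ht
  have hbary := (h.solvesBalance hFG hu).eqOn hFG hϑ hu (h'.solvesBalance hFG hu)
  obtain ⟨C, hC0, hC⟩ := hFG.sublinear
  obtain ⟨R₁, hR₁, hbound₁⟩ := SolvesLifted.exists_support_bound hFG ϑ hϑ
  obtain ⟨R₂, hR₂, hbound₂⟩ := SolvesBalance.exists_support_bound hFG ϑ hϑ
  set R := max R₁ R₂
  have hR : 0 ≤ R := hR₁.trans (le_max_left _ _)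
  obtain ⟨M, hM0, hM⟩ := hFG.lipschitz (cube n R) (isCompact_cube n R)
  set M₀ := Real.exp (C * T)
  have hcarr : ∀ σ, SolvesLifted T F G ϑ u σ → ∀ t ∈ Icc 0 T,
      CarriedBy (bary (σ t)).1 (cube n R) := fun σ hσ t ht => by
    have : ∀ᵐ x ∂(bary (σ t)).1, x ∈ cube n R := by
      filter_upwards [hbound₂ u hu _ (hσ.solvesBalance hFG hu) t ht] with x hx
      exact mem_cube_of_norm_le (hx.trans (le_max_right _ _))
    exact this
  have hmass : ∀ σ, SolvesLifted T F G ϑ u σ → ∀ t ∈ Icc 0 T,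
      (bary (σ t)).1.real univ ≤ M₀ := fun σ hσ t ht =>
    (hσ.solvesBalance hFG hu).mass_le hFG hC hC0 hϑ hu ht
  have hw : ∀ σ, SolvesLifted T F G ϑ u σ → WeakCurve T 1
      (C * (1 + M₀) + R * C) (M + C + R * M)
      (fun t z => (F t (u t) (bary (σ t)) (cubeProj R z.1),
        clamp (-R) R z.2 * G t (u t) (bary (σ t)) (cubeProj R z.1)))
      (fun _ _ => 0) (fun t => (σ t).1) := fun σ hσ => by
    have hclamp : ∀ y, |clamp (-R) R y| ≤ R := fun y =>
      abs_le.2 (clamp_mem (by linarith) y)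
    refine ⟨fun t _ => inferInstance, fun t _ => by simp, hσ.absCont, fun f hf => ?_, ?_, ?_⟩
    · filter_upwards [hσ.weak f hf, ae_restrict_mem measurableSet_Icc] with t ht htm
      convert ht using 1
      refine integral_congr_ae ?_
      filter_upwards [hbound₁ u hu σ hσ t htm] with z hz
      have h1 : cubeProj R z.1 = z.1 :=
        cubeProj_eq (mem_cube_of_norm_le (hz.1.trans (le_max_left _ _)))
      have h2 : clamp (-R) R z.2 = z.2 :=
        clamp_eq (abs_le.1 (hz.2.trans (le_max_left _ _)))
      simp only [h1, h2, zero_mul, add_zero]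
      rfl
    · filter_upwards [hu, ae_restrict_mem measurableSet_Icc] with t hut htm z
      have h1 := hC t htm _ hut (bary (σ t)) (cubeProj R z.1)
      have h0 : 0 ≤ C * (1 + M₀) := by positivity
      have h0' : 0 ≤ R * C := by positivity
      refine ⟨?_, by rw [abs_zero]; positivity⟩
      rw [Prod.norm_def]
      refine max_le ?_ ?_
      · have : C * (1 + (bary (σ t)).1.real univ) ≤ C * (1 + M₀) := by
          gcongr
          exact hmass σ hσ t htm
        simp only
        linarith [h1.1]
      · simp only [Real.norm_eq_abs, abs_mul]
        have := mul_le_mul (hclamp z.2) h1.2 (abs_nonneg _) hR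
        linarith
    · filter_upwards [hu, ae_restrict_mem measurableSet_Icc] with t hut htm z z'
      have h1 := hM t htm _ hut (bary (σ t)) (bary (σ t)) (hcarr σ hσ t htm) (hcarr σ hσ t htm) _
        (cubeProj_mem hR z.1) _ (cubeProj_mem hR z'.1)
      rw [krDist_self, add_zero] at h1
      have h2 : M * ‖cubeProj R z.1 - cubeProj R z'.1‖ ≤ M * ‖z - z'‖ := by
        gcongr
        exact (norm_cubeProj_sub_le R z.1 z'.1).trans (norm_fst_le (z - z'))
      have h3 := (hC t htm _ hut (bary (σ t)) (cubeProj R z.1)).2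
      have h4 : |clamp (-R) R z.2 - clamp (-R) R z'.2| ≤ ‖z - z'‖ :=
        (abs_clamp_sub_le _ _ _ _).trans (norm_snd_le (z - z'))
      have hn := norm_nonneg (z - z')
      have h0 : 0 ≤ M * ‖z - z'‖ := by positivity
      have h0' : 0 ≤ C * ‖z - z'‖ := by positivity
      have h0'' : 0 ≤ R * (M * ‖z - z'‖) := by positivity
      refine ⟨?_, by rw [sub_self, abs_zero]; positivity⟩
      rw [Prod.norm_def]
      refine max_le ?_ ?_
      · simp only [Prod.fst_sub]
        linarith [h1.1]
      · simp only [Prod.snd_sub, Real.norm_eq_abs]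
        set c := clamp (-R) R z.2
        set c' := clamp (-R) R z'.2
        set γ := G t (u t) (bary (σ t)) (cubeProj R z.1)
        set γ' := G t (u t) (bary (σ t)) (cubeProj R z'.1)
        have e : c * γ - c' * γ' = (c - c') * γ + c' * (γ - γ') := by ring
        have h5 : |(c - c') * γ| ≤ ‖z - z'‖ * C := by
          rw [abs_mul]
          gcongr
        have h6 : |c' * (γ - γ')| ≤ R * (M * ‖z - z'‖) := by
          rw [abs_mul]
          gcongr
          · exact hclamp z'.2
          · exact h1.2.trans h2
        rw [e]
        refine (abs_add_le _ _).trans ?_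
        linarith
  refine Subtype.ext ((hw ρ h).eq_of_initial_eq (hw ρ' h') (M := 0) (by positivity) (by positivity)
    (by positivity) le_rfl ?_ (by rw [h.initial, h'.initial]) ht)
  filter_upwards [ae_restrict_mem measurableSet_Icc] with s hs a _ z
  have : bary (ρ s) = bary (ρ' s) := hbary hs
  simp [this]

end

/-! ### An integral equation of Carathéodory type -/

open scoped BoundedContinuousFunction

section

variable {P E : Type*}

/-- The state at time `s` of a space-time family. -/
noncomputable def slice [TopologicalSpace P] [PseudoMetricSpace E] (Z : (ℝ × P) →ᵇ E)
    (s : ℝ) : P →ᵇ E :=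
  Z.compContinuous ⟨fun x => (s, x), by fun_prop⟩

@[simp]
theorem slice_apply [TopologicalSpace P] [PseudoMetricSpace E] (Z : (ℝ × P) →ᵇ E) (s : ℝ)
    (x : P) : slice Z s x = Z (s, x) := rfl

variable [MetricSpace P] [MeasurableSpace P] [NormedAddCommGroup E] [MeasurableSpace E]

/-- A bounded right-hand side `B z s x` for the evolution of a family of points `z : P → E`
coupled through their distribution under `ϑ`: measurable in time `s`, continuous in the label `x`,
Lipschitz in the state `z`. -/
structure CaratheodoryField (ϑ : Measure P) (V L : ℝ) (B : (P →ᵇ E) → ℝ → P → E) : Prop where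
  bound : ∀ z s x, ‖B z s x‖ ≤ V
  continuous : ∀ z s, Continuous (B z s)
  measurable : ∀ z x, Measurable fun s => B z s x
  lip : ∀ z z' s x, ‖B z s x - B z' s x‖ ≤ L * (‖z x - z' x‖ + ∫ y, ‖z y - z' y‖ ∂ϑ)

variable {ϑ : Measure P} {V L : ℝ} {B : (P →ᵇ E) → ℝ → P → E}

theorem CaratheodoryField.continuous_slice [BorelSpace P] [IsProbabilityMeasure ϑ]
    (hB : CaratheodoryField ϑ V L B)
    (Z : (ℝ × P) →ᵇ E) (s : ℝ) (x : P) : Continuous fun r => B (slice Z r) s x := by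
  refine continuous_iff_continuousAt.2 fun r₀ => ?_
  rw [ContinuousAt, tendsto_iff_norm_sub_tendsto_zero]
  have hc : ∀ y, Continuous fun r => ‖Z (r, y) - Z (r₀, y)‖ := fun y => by fun_prop
  have h1 : Continuous fun r => ∫ y, ‖Z (r, y) - Z (r₀, y)‖ ∂ϑ := by
    refine continuous_of_dominated (bound := fun _ => 2 * ‖Z‖) (fun r => ?_)
      (fun r => Eventually.of_forall fun y => ?_) (integrable_const _)
      (Eventually.of_forall hc)
    · exact (by fun_prop : Continuous fun y => ‖Z (r, y) - Z (r₀, y)‖).aestronglyMeasurable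
    · rw [norm_norm, ← dist_eq_norm]
      exact Z.dist_le_two_norm _ _
  have h2 : Tendsto (fun r => L * (‖Z (r, x) - Z (r₀, x)‖ + ∫ y, ‖Z (r, y) - Z (r₀, y)‖ ∂ϑ))
      (𝓝 r₀) (𝓝 0) := by
    have := (((hc x).add h1).const_mul L).tendsto r₀
    simpa using this
  exact squeeze_zero (fun _ => norm_nonneg _) (fun r => hB.lip _ _ s x) h2

theorem CaratheodoryField.measurable_time [BorelSpace P] [BorelSpace E]
    [IsProbabilityMeasure ϑ] (hB : CaratheodoryField ϑ V L B) (Z : (ℝ × P) →ᵇ E) (x : P) :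
    Measurable fun s => B (slice Z s) s x := by
  have h := measurable_uncurry_of_continuous_of_measurable (u := fun r s => B (slice Z r) s x)
    (fun s => hB.continuous_slice Z s x) (fun r => hB.measurable (slice Z r) x)
  exact h.comp (measurable_id.prodMk measurable_id)

theorem CaratheodoryField.measurable_uncurry [SecondCountableTopology P] [BorelSpace P]
    [BorelSpace E] [IsProbabilityMeasure ϑ] (hB : CaratheodoryField ϑ V L B)
    (Z : (ℝ × P) →ᵇ E) : Measurable fun p : P × ℝ => B (slice Z p.2) p.2 p.1 :=
  measurable_uncurry_of_continuous_of_measurable (u := fun x s => B (slice Z s) s x)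
    (fun s => hB.continuous _ s) (fun x => hB.measurable_time Z x)

theorem CaratheodoryField.intervalIntegrable [BorelSpace P] [BorelSpace E]
    [SecondCountableTopology E] [IsProbabilityMeasure ϑ] (hB : CaratheodoryField ϑ V L B)
    (Z : (ℝ × P) →ᵇ E) (x : P) (a b : ℝ) :
    IntervalIntegrable (fun s => B (slice Z s) s x) volume a b :=
  (intervalIntegrable_const (c := V)).mono_fun
    (hB.measurable_time Z x).aestronglyMeasurable
    (Eventually.of_forall fun s => (hB.bound _ s x).trans (le_abs_self V))

variable [NormedSpace ℝ E]

theorem CaratheodoryField.norm_integral_le (hB : CaratheodoryField ϑ V L B)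
    (Z : (ℝ × P) →ᵇ E) {t : ℝ} (ht : 0 ≤ t) (x : P) :
    ‖∫ s in (0 : ℝ)..t, B (slice Z s) s x‖ ≤ V * t := by
  have := intervalIntegral.norm_integral_le_of_norm_le_const (a := 0) (b := t)
    (f := fun s => B (slice Z s) s x) (C := V) (fun s _ => hB.bound _ s x)
  rwa [sub_zero, abs_of_nonneg ht] at this

theorem CaratheodoryField.continuous_integral [BorelSpace P] [BorelSpace E]
    [SecondCountableTopology E] [IsProbabilityMeasure ϑ] (hB : CaratheodoryField ϑ V L B)
    (Z : (ℝ × P) →ᵇ E) :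
    Continuous fun p : ℝ × P => ∫ s in (0 : ℝ)..p.1, B (slice Z s) s p.2 := by
  refine continuous_iff_continuousAt.2 fun ⟨t₀, x₀⟩ => ?_
  have h := intervalIntegral.continuousAt_parametric_primitive_of_dominated (μ := volume)
    (F := fun x s => B (slice Z s) s x) (fun _ => V) (-|t₀| - 1) (|t₀| + 1) (a₀ := 0) (b₀ := t₀)
    (x₀ := x₀) (fun x => (hB.measurable_time Z x).aestronglyMeasurable)
    (Eventually.of_forall fun x => Eventually.of_forall fun s => hB.bound _ s x)
    (by simp) (Eventually.of_forall fun s => (hB.continuous _ s).continuousAt)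
    ⟨by linarith [abs_nonneg t₀], by linarith [abs_nonneg t₀]⟩
    ⟨by linarith [neg_abs_le t₀], by linarith [le_abs_self t₀]⟩ (by simp)
  exact h.comp (f := fun p : ℝ × P => (p.2, p.1)) (x := (t₀, x₀)) (by fun_prop)

/-- Existence of solutions: the integral operator is a contraction on bounded continuous functions
for the supremum norm weighted by `exp (-4 L t)`. -/
theorem CaratheodoryField.exists_solution [BorelSpace P] [CompleteSpace E] [BorelSpace E]
    [SecondCountableTopology E] [IsProbabilityMeasure ϑ] (hB : CaratheodoryField ϑ V L B)
    (hL : 0 < L) {T : ℝ}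
    (hT : 0 ≤ T) : ∃ Z : (ℝ × P) →ᵇ E, ∀ t ∈ Icc 0 T, ∀ x,
      Z (t, x) = ∫ s in (0 : ℝ)..t, B (slice Z s) s x := by
  have : Nonempty P := by
    by_contra h
    rw [not_nonempty_iff] at h
    have h1 : ϑ univ = 1 := measure_univ
    rw [univ_eq_empty_iff.2 h, measure_empty] at h1
    exact zero_ne_one h1
  have hV : 0 ≤ V := (norm_nonneg _).trans (hB.bound 0 0 (Classical.arbitrary P))
  set lam := 4 * L with hlam
  have hlam0 : 0 < lam := by positivity
  set τ : ℝ → ℝ := clamp 0 T with hτ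
  have hτm : ∀ t, τ t ∈ Icc 0 T := clamp_mem hT
  have hτc : Continuous τ := continuous_clamp 0 T
  set up : ((ℝ × P) →ᵇ E) → ((ℝ × P) →ᵇ E) := fun W =>
    BoundedContinuousFunction.ofNormedAddCommGroup (fun p => Real.exp (lam * τ p.1) • W p)
      (by fun_prop) (Real.exp (lam * T) * ‖W‖) (fun p => by
        rw [norm_smul, Real.norm_eq_abs, abs_of_pos (Real.exp_pos _)]
        gcongr
        · exact (hτm p.1).2
        · exact W.norm_coe_le_norm p) with hup
  have hup_apply : ∀ W p, up W p = Real.exp (lam * τ p.1) • W p := fun _ _ => rfl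
  set Ψ : ((ℝ × P) →ᵇ E) → ((ℝ × P) →ᵇ E) := fun W =>
    BoundedContinuousFunction.ofNormedAddCommGroup
      (fun p => Real.exp (-lam * τ p.1) • ∫ s in (0 : ℝ)..τ p.1, B (slice (up W) s) s p.2)
      (((by fun_prop : Continuous fun p : ℝ × P => Real.exp (-lam * τ p.1))).smul
        ((hB.continuous_integral (up W)).comp
          (by fun_prop : Continuous fun p : ℝ × P => (τ p.1, p.2))))
      (V * T) (fun p => by
        rw [norm_smul, Real.norm_eq_abs, abs_of_pos (Real.exp_pos _)]
        have h1 := hB.norm_integral_le (up W) (hτm p.1).1 p.2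
        have h2 : Real.exp (-lam * τ p.1) ≤ 1 := by
          rw [Real.exp_le_one_iff]
          have := mul_nonneg hlam0.le (hτm p.1).1
          linarith
        calc _ ≤ 1 * (V * τ p.1) := by gcongr
          _ ≤ V * T := by rw [one_mul]; gcongr; exact (hτm p.1).2) with hΨ
  have hΨ_apply : ∀ W p, Ψ W p
      = Real.exp (-lam * τ p.1) • ∫ s in (0 : ℝ)..τ p.1, B (slice (up W) s) s p.2 :=
    fun _ _ => rfl
  have hcontr : ContractingWith (1 / 2) Ψ := by
    refine ⟨by norm_num, LipschitzWith.of_dist_le_mul fun W W' => ?_⟩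
    rw [BoundedContinuousFunction.dist_le (by positivity)]
    rintro ⟨t, x⟩
    rw [dist_eq_norm, hΨ_apply, hΨ_apply, ← smul_sub,
      ← intervalIntegral.integral_sub (hB.intervalIntegrable _ _ _ _)
        (hB.intervalIntegrable _ _ _ _), norm_smul, Real.norm_eq_abs, abs_of_pos (Real.exp_pos _)]
    simp only
    have hd := dist_nonneg (x := W) (y := W')
    have hpt : ∀ s ∈ Icc 0 T, ∀ y,
        ‖up W (s, y) - up W' (s, y)‖ ≤ Real.exp (lam * s) * dist W W' := fun s hs y => by
      rw [hup_apply, hup_apply, ← smul_sub, norm_smul, Real.norm_eq_abs,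
        abs_of_pos (Real.exp_pos _), ← dist_eq_norm]
      simp only [hτ, clamp_eq hs]
      gcongr
      exact BoundedContinuousFunction.dist_coe_le_dist _
    have hint : ‖∫ s in (0 : ℝ)..τ t, (B (slice (up W) s) s x - B (slice (up W') s) s x)‖
        ≤ ∫ s in (0 : ℝ)..τ t, 2 * L * dist W W' * Real.exp (lam * s) := by
      refine intervalIntegral.norm_integral_le_of_norm_le (hτm t).1
        (Eventually.of_forall fun s hs => ?_) (Continuous.intervalIntegrable (by fun_prop) _ _)
      have hs' : s ∈ Icc 0 T := ⟨hs.1.le, hs.2.trans (hτm t).2⟩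
      refine (hB.lip _ _ s x).trans ?_
      have h1 := hpt s hs' x
      have h2 : ∫ y, ‖slice (up W) s y - slice (up W') s y‖ ∂ϑ
          ≤ Real.exp (lam * s) * dist W W' := by
        have h3 : ∀ y, ‖slice (up W) s y - slice (up W') s y‖ ≤ Real.exp (lam * s) * dist W W' :=
          hpt s hs'
        have h4 := norm_integral_le_of_norm_le_const (μ := ϑ)
          (f := fun y => ‖slice (up W) s y - slice (up W') s y‖)
          (Eventually.of_forall fun y => by rw [norm_norm]; exact h3 y)
        rw [probReal_univ, mul_one] at h4
        exact (Real.le_norm_self _).trans h4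
      calc _ ≤ L * (Real.exp (lam * s) * dist W W' + Real.exp (lam * s) * dist W W') := by
            gcongr
            exact h1
        _ = _ := by ring
    have hexp : ∫ s in (0 : ℝ)..τ t, 2 * L * dist W W' * Real.exp (lam * s)
        = 1 / 2 * dist W W' * (Real.exp (lam * τ t) - 1) := by
      rw [intervalIntegral.integral_const_mul, intervalIntegral.integral_comp_mul_left _ hlam0.ne',
        integral_exp, mul_zero, Real.exp_zero, smul_eq_mul, hlam]
      field_simp
      ring
    rw [hexp] at hint
    calc _ ≤ Real.exp (-lam * τ t) * (1 / 2 * dist W W' * (Real.exp (lam * τ t) - 1)) := by gcongr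
      _ ≤ Real.exp (-lam * τ t) * (1 / 2 * dist W W' * Real.exp (lam * τ t)) := by
          gcongr; linarith
      _ = 1 / 2 * dist W W' * (Real.exp (-lam * τ t) * Real.exp (lam * τ t)) := by ring
      _ = _ := by rw [← Real.exp_add]; simp
  refine ⟨up (hcontr.fixedPoint Ψ), fun t ht x => ?_⟩
  have hfix : Ψ (hcontr.fixedPoint Ψ) = hcontr.fixedPoint Ψ := hcontr.fixedPoint_isFixedPt
  rw [hup_apply]
  conv_lhs => rw [← hfix]
  rw [hΨ_apply, smul_smul, ← Real.exp_add]
  simp only [hτ, clamp_eq ht]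
  simp

end

/-! ### Existence -/

theorem abs_exp_sub_exp_le {a b c : ℝ} (ha : a ≤ c) (hb : b ≤ c) :
    |Real.exp a - Real.exp b| ≤ Real.exp c * |a - b| := by
  wlog h : b ≤ a generalizing a b
  · rw [abs_sub_comm, abs_sub_comm a]
    exact this hb ha (le_of_not_ge h)
  rw [abs_of_nonneg (by simpa using h), abs_of_nonneg (by linarith)]
  have h1 := Real.add_one_le_exp (b - a)
  have h2 : Real.exp b = Real.exp a * Real.exp (b - a) := by rw [← Real.exp_add]; ring_nf
  have h3 : Real.exp a ≤ Real.exp c := by gcongr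
  calc Real.exp a - Real.exp b ≤ Real.exp a * (a - b) := by
        rw [h2]; nlinarith [Real.exp_pos a]
    _ ≤ _ := by gcongr

section

variable {m n : ℕ}

/-- The point `(x + z₁(x), exp z₂(x))` of `ℝⁿ × ℝ⁺` reached by the particle starting from `(x, 1)`
with displacement `z₁(x)` and logarithmic weight `z₂(x)`, truncated to a compact set. -/
noncomputable def particle (R c : ℝ) (z : Rn n →ᵇ Rn n × ℝ) (x : Rn n) : Rn n × ℝ :=
  (cubeProj R (x + (z x).1), Real.exp (clamp (-c) c (z x).2))

theorem continuous_particle (R c : ℝ) (z : Rn n →ᵇ Rn n × ℝ) : Continuous (particle R c z) := by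
  unfold particle
  fun_prop

theorem particle_snd_le {R c : ℝ} (hc : 0 ≤ c) (z : Rn n →ᵇ Rn n × ℝ) (x : Rn n) :
    (particle R c z x).2 ≤ Real.exp c :=
  Real.exp_le_exp.2 (clamp_mem (by linarith) _).2

theorem norm_particle_fst_sub_le (R c : ℝ) (z z' : Rn n →ᵇ Rn n × ℝ) (x : Rn n) :
    ‖(particle R c z x).1 - (particle R c z' x).1‖ ≤ ‖z x - z' x‖ := by
  refine (norm_cubeProj_sub_le R _ _).trans ?_
  rw [add_sub_add_left_eq_sub]
  exact norm_fst_le (z x - z' x)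

theorem abs_particle_snd_sub_le {R c : ℝ} (hc : 0 ≤ c) (z z' : Rn n →ᵇ Rn n × ℝ) (x : Rn n) :
    |(particle R c z x).2 - (particle R c z' x).2| ≤ Real.exp c * ‖z x - z' x‖ := by
  refine (abs_exp_sub_exp_le (clamp_mem (by linarith) _).2 (clamp_mem (by linarith) _).2).trans ?_
  gcongr
  exact (abs_clamp_sub_le _ _ _ _).trans (norm_snd_le (z x - z' x))

theorem particle_mem {R c : ℝ} (hR : 0 ≤ R) (hc : 0 ≤ c) (z : Rn n →ᵇ Rn n × ℝ) (x : Rn n) :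
    particle R c z x ∈ cube n R ×ˢ Icc 0 (Real.exp c) :=
  ⟨cubeProj_mem hR _, (Real.exp_pos _).le, particle_snd_le hc z x⟩

/-- The distribution of the particles whose starting points have distribution `ϑ`. -/
noncomputable def particleLaw (ϑ : StateSpace n) (hϑ : IsProbabilityMeasure ϑ.1) {R c : ℝ}
    (hR : 0 ≤ R) (hc : 0 ≤ c) (z : Rn n →ᵇ Rn n × ℝ) : LiftedSpace n :=
  ⟨ϑ.1.map (particle R c z),
    Measure.isProbabilityMeasure_map (continuous_particle R c z).aemeasurable,
    cube n R ×ˢ Icc 0 (Real.exp c), (isCompact_cube n R).prod isCompact_Icc,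
    fun _ hz => ⟨mem_univ _, hz.2.1⟩, by
      have h : ∀ᵐ z' ∂(ϑ.1.map (particle R c z)), z' ∈ cube n R ×ˢ Icc 0 (Real.exp c) := by
        refine (ae_map_iff (continuous_particle R c z).aemeasurable
          ((isCompact_cube n R).prod isCompact_Icc).measurableSet).2 ?_
        exact Eventually.of_forall fun x => particle_mem hR hc z x
      exact h⟩

section

variable (ϑ : StateSpace n) (hϑ : IsProbabilityMeasure ϑ.1) {R c : ℝ} (hR : 0 ≤ R) (hc : 0 ≤ c)

theorem integral_particleLaw (z : Rn n →ᵇ Rn n × ℝ) {φ : Rn n × ℝ → ℝ} (hφ : Continuous φ) :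
    ∫ y, φ y ∂(particleLaw ϑ hϑ hR hc z).1 = ∫ x, φ (particle R c z x) ∂ϑ.1 :=
  integral_map (continuous_particle R c z).aemeasurable hφ.aestronglyMeasurable

theorem integral_bary_particleLaw (z : Rn n →ᵇ Rn n × ℝ) {φ : Rn n → ℝ} (hφ : Continuous φ) :
    ∫ x, φ x ∂(bary (particleLaw ϑ hϑ hR hc z)).1
      = ∫ x, (particle R c z x).2 * φ (particle R c z x).1 ∂ϑ.1 := by
  rw [integral_bary _ hφ, integral_particleLaw ϑ hϑ hR hc z (by fun_prop)]

theorem mass_bary_particleLaw_le (z : Rn n →ᵇ Rn n × ℝ) :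
    (bary (particleLaw ϑ hϑ hR hc z)).1.real univ ≤ Real.exp c := by
  have h := integral_bary_particleLaw ϑ hϑ hR hc z (φ := fun _ => 1) continuous_const
  simp only [integral_const, smul_eq_mul, mul_one] at h
  rw [h]
  have h1 := continuous_particle R c z
  calc ∫ x, (particle R c z x).2 ∂ϑ.1 ≤ ∫ _, Real.exp c ∂ϑ.1 :=
        integral_mono (ϑ.integrable (by fun_prop)) (integrable_const _)
          fun x => particle_snd_le hc z x
    _ = Real.exp c := by simp

theorem carriedBy_bary_particleLaw (z : Rn n →ᵇ Rn n × ℝ) :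
    CarriedBy (bary (particleLaw ϑ hϑ hR hc z)).1 (cube n R) := by
  have hm : MeasurableSet (cube n R) := (isCompact_cube n R).measurableSet
  have h : ∀ᵐ x ∂(bary (particleLaw ϑ hϑ hR hc z)).1, x ∈ cube n R := by
    change ∀ᵐ x ∂(baryMeasure (ϑ.1.map (particle R c z))), x ∈ cube n R
    unfold baryMeasure
    refine (ae_map_iff measurable_fst.aemeasurable hm).2 ?_
    refine (withDensity_absolutelyContinuous _ _).ae_le ?_
    refine (ae_map_iff (continuous_particle R c z).aemeasurable (measurable_fst hm)).2 ?_
    exact Eventually.of_forall fun x => (particle_mem hR hc z x).1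
  exact h

/-- The barycentric projection of the law of the particles is Lipschitz in the particles. -/
theorem krDist_bary_particleLaw_le (z z' : Rn n →ᵇ Rn n × ℝ) :
    krDist (bary (particleLaw ϑ hϑ hR hc z)) (bary (particleLaw ϑ hϑ hR hc z'))
      ≤ 2 * Real.exp c * ∫ y, ‖z y - z' y‖ ∂ϑ.1 := by
  refine krDist_le_of_KRLe fun φ hφ => ?_
  have hφc := hφ.continuous
  have h1 := continuous_particle R c z
  have h2 := continuous_particle R c z'
  rw [integral_bary_particleLaw ϑ hϑ hR hc z hφc, integral_bary_particleLaw ϑ hϑ hR hc z' hφc,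
    ← integral_sub (ϑ.integrable (by fun_prop)) (ϑ.integrable (by fun_prop)),
    ← integral_const_mul]
  refine integral_mono (ϑ.integrable (by fun_prop)) (ϑ.integrable (by fun_prop)) fun x => ?_
  set p := particle R c z x with hp
  set p' := particle R c z' x with hp'
  have h3 : |(p.2 - p'.2) * φ p.1| ≤ Real.exp c * ‖z x - z' x‖ * 1 := by
    rw [abs_mul]
    gcongr
    · exact abs_particle_snd_sub_le hc z z' x
    · exact hφ.1 _
  have h4 : |p'.2 * (φ p.1 - φ p'.1)| ≤ Real.exp c * ‖z x - z' x‖ := by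
    have h5 : 0 < p'.2 := Real.exp_pos _
    rw [abs_mul, abs_of_pos h5]
    gcongr
    · exact particle_snd_le hc z' x
    · refine (hφ.2 _ _).trans ?_
      rw [one_mul]
      exact norm_particle_fst_sub_le R c z z' x
  change p.2 * φ p.1 - p'.2 * φ p'.1 ≤ 2 * Real.exp c * ‖z x - z' x‖
  linarith [le_abs_self ((p.2 - p'.2) * φ p.1), le_abs_self (p'.2 * (φ p.1 - φ p'.1))]

/-- The velocities `(F, G)` of the displacements and of the logarithmic weights of the particles,
set to zero at the times where the control leaves `U`. -/
noncomputable def particleField (T : ℝ) (U : Set (Rn m)) (F : NonlocalField m n)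
    (G : NonlocalDensity m n) (u : ℝ → Rn m) (z : Rn n →ᵇ Rn n × ℝ) (s : ℝ) (x : Rn n) :
    Rn n × ℝ :=
  indicator {s | (s, u s) ∈ Icc 0 T ×ˢ U} (fun s =>
    (F s (u s) (bary (particleLaw ϑ hϑ hR hc z)) (particle R c z x).1,
      G s (u s) (bary (particleLaw ϑ hϑ hR hc z)) (particle R c z x).1)) s

variable {T : ℝ} {U : Set (Rn m)} {F : NonlocalField m n} {G : NonlocalDensity m n}

theorem caratheodoryField_particleField (hU : IsCompact U) (hFG : RegularData T U F G) {C M : ℝ}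
    (hC : ∀ t ∈ Icc 0 T, ∀ u ∈ U, ∀ (μ : StateSpace n) (x : Rn n),
      ‖F t u μ x‖ ≤ C * (1 + μ.1.real univ) ∧ |G t u μ x| ≤ C) (hC0 : 0 < C)
    (hM : ∀ t ∈ Icc 0 T, ∀ u ∈ U, ∀ μ μ' : StateSpace n, CarriedBy μ.1 (cube n R) →
      CarriedBy μ'.1 (cube n R) → ∀ x ∈ cube n R, ∀ x' ∈ cube n R,
        ‖F t u μ x - F t u μ' x'‖ ≤ M * (‖x - x'‖ + krDist μ μ') ∧
        |G t u μ x - G t u μ' x'| ≤ M * (‖x - x'‖ + krDist μ μ')) (hM0 : 0 < M)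
    {u : ℝ → Rn m} (hu : Measurable u) :
    CaratheodoryField ϑ.1 (C * (1 + Real.exp c)) (M * (1 + 2 * Real.exp c))
      (particleField ϑ hϑ hR hc T U F G u) where
  bound z s x := by
    unfold particleField
    by_cases hs : s ∈ {s | (s, u s) ∈ Icc 0 T ×ˢ U}
    · rw [indicator_of_mem hs, Prod.norm_def]
      have h1 := hC s hs.1 _ hs.2 (bary (particleLaw ϑ hϑ hR hc z)) (particle R c z x).1
      have h2 := mass_bary_particleLaw_le ϑ hϑ hR hc z
      have h3 : C ≤ C * (1 + Real.exp c) :=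
        le_mul_of_one_le_right hC0.le (by linarith [Real.exp_pos c])
      exact max_le (h1.1.trans (by gcongr)) (h1.2.trans h3)
    · rw [indicator_of_notMem hs, norm_zero]
      positivity
  continuous z s := by
    unfold particleField
    by_cases hs : s ∈ {s | (s, u s) ∈ Icc 0 T ×ˢ U}
    · simp only [indicator_of_mem hs]
      obtain ⟨hF, hG⟩ := hFG.continuous_space hs.1 hs.2 (bary (particleLaw ϑ hϑ hR hc z))
      have := continuous_particle R c z
      fun_prop
    · simp only [indicator_of_notMem hs]
      exact continuous_const
  measurable z x := by
    set μ := bary (particleLaw ϑ hϑ hR hc z)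
    set p := (particle R c z x).1
    have hS : MeasurableSet (Icc 0 T ×ˢ U) := measurableSet_Icc.prod hU.isClosed.measurableSet
    have h1 : ContinuousOn (fun q : ℝ × Rn m => (F q.1 q.2 μ p, G q.1 q.2 μ p)) (Icc 0 T ×ˢ U) :=
      (hFG.continuous_F μ p).prodMk (hFG.continuous_G μ p)
    classical
    have h2 := h1.measurable_piecewise (continuousOn_const (c := (0 : Rn n × ℝ))) hS
    have h3 : (fun s => particleField ϑ hϑ hR hc T U F G u z s x)
        = (Icc 0 T ×ˢ U).piecewise (fun q : ℝ × Rn m => (F q.1 q.2 μ p, G q.1 q.2 μ p))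
          (fun _ => 0) ∘ fun s => (s, u s) := by
      ext1 s
      by_cases hs : (s, u s) ∈ Icc 0 T ×ˢ U
      · rw [Function.comp_apply, piecewise_eq_of_mem _ _ _ hs]
        exact indicator_of_mem (s := {s | (s, u s) ∈ Icc 0 T ×ˢ U}) hs _
      · rw [Function.comp_apply, piecewise_eq_of_notMem _ _ _ hs]
        exact indicator_of_notMem (s := {s | (s, u s) ∈ Icc 0 T ×ˢ U}) hs _
    rw [h3]
    exact h2.comp (measurable_id.prodMk hu)
  lip z z' s x := by
    have hI : 0 ≤ ∫ y, ‖z y - z' y‖ ∂ϑ.1 := integral_nonneg fun _ => norm_nonneg _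
    unfold particleField
    by_cases hs : s ∈ {s | (s, u s) ∈ Icc 0 T ×ˢ U}
    · rw [indicator_of_mem hs, indicator_of_mem hs]
      have h1 := hM s hs.1 _ hs.2 _ _ (carriedBy_bary_particleLaw ϑ hϑ hR hc z)
        (carriedBy_bary_particleLaw ϑ hϑ hR hc z') _ (particle_mem hR hc z x).1 _
        (particle_mem hR hc z' x).1
      have h2 := krDist_bary_particleLaw_le ϑ hϑ hR hc z z'
      have h3 := norm_particle_fst_sub_le R c z z' x
      have h4 : M * (‖(particle R c z x).1 - (particle R c z' x).1‖
          + krDist (bary (particleLaw ϑ hϑ hR hc z)) (bary (particleLaw ϑ hϑ hR hc z')))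
          ≤ M * (1 + 2 * Real.exp c) * (‖z x - z' x‖ + ∫ y, ‖z y - z' y‖ ∂ϑ.1) := by
        rw [mul_assoc]
        refine mul_le_mul_of_nonneg_left ?_ hM0.le
        have := Real.exp_pos c
        nlinarith [mul_nonneg this.le (norm_nonneg (z x - z' x))]
      rw [Prod.norm_def]
      exact max_le (h1.1.trans h4) (h1.2.trans h4)
    · rw [indicator_of_notMem hs, indicator_of_notMem hs, sub_self, norm_zero]
      positivity

end

variable {T : ℝ} {U : Set (Rn m)} {F : NonlocalField m n} {G : NonlocalDensity m n}

/-- The lifted equation is solved by the law of the particles `(X, Y)` which follow the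
characteristics `X' = F`, `Y' = Y G` from `(x, 1)`. -/
theorem exists_solvesLifted (hT : 0 < T) (hU : IsCompact U) (hFG : RegularData T U F G)
    (ϑ : StateSpace n) (hϑ : IsProbabilityMeasure ϑ.1) {u : ℝ → Rn m} (hum : Measurable u)
    (hu : ∀ᵐ t ∂(volume.restrict (Icc 0 T)), u t ∈ U) : ∃ ρ, SolvesLifted T F G ϑ u ρ := by
  obtain ⟨C, hC0, hC⟩ := hFG.sublinear
  obtain ⟨K, hK, hϑK⟩ := ϑ.2.2
  obtain ⟨R₀', hR₀'⟩ := hK.isBounded.exists_norm_le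
  have hϑK' : ∀ᵐ x ∂ϑ.1, x ∈ K := hϑK
  set R₀ := max R₀' 0
  have hR₀ : ∀ x ∈ K, ‖x‖ ≤ R₀ := fun x hx => (hR₀' x hx).trans (le_max_left _ _)
  have hR₀0 : 0 ≤ R₀ := le_max_right _ _
  have hc : 0 ≤ C * T := by positivity
  set c := C * T with hcdef
  set V := C * (1 + Real.exp c) with hV
  have hV0 : 0 ≤ V := by positivity
  have hR : 0 ≤ R₀ + V * T := by positivity
  set R := R₀ + V * T with hRdef
  obtain ⟨M, hM0, hM⟩ := hFG.lipschitz (cube n R) (isCompact_cube n R)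
  set B := particleField ϑ hϑ hR hc T U F G u with hBdef
  have hB : CaratheodoryField ϑ.1 V (M * (1 + 2 * Real.exp c)) B :=
    caratheodoryField_particleField ϑ hϑ hR hc hU hFG hC hC0 hM hM0 hum
  obtain ⟨Z, hZ⟩ := hB.exists_solution (by positivity) hT.le
  set ρ : ℝ → LiftedSpace n := fun t => particleLaw ϑ hϑ hR hc (slice Z t) with hρ
  set S : ℝ → Rn n → Rn n × ℝ := fun t => particle R c (slice Z t) with hS
  have hBV : ∀ s x, ‖B (slice Z s) s x‖ ≤ V := fun s x => hB.bound _ s x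
  -- the truncations are inactive along the solution
  have hZ1 : ∀ t ∈ Icc 0 T, ∀ x, ‖Z (t, x)‖ ≤ V * T := fun t ht x => by
    rw [hZ t ht]
    exact (hB.norm_integral_le Z ht.1 x).trans (by gcongr; exact ht.2)
  have hZ2 : ∀ t ∈ Icc 0 T, ∀ x, |(Z (t, x)).2| ≤ c := fun t ht x => by
    rw [hZ t ht]
    have h1 := (ContinuousLinearMap.snd ℝ (Rn n) ℝ).intervalIntegral_comp_comm
      (hB.intervalIntegrable Z x 0 t)
    simp only [ContinuousLinearMap.coe_snd'] at h1
    rw [← h1]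
    have h2 := intervalIntegral.norm_integral_le_of_norm_le_const (a := 0) (b := t)
      (f := fun s => (B (slice Z s) s x).2) (C := C) (fun s _ => by
        rw [hBdef]
        unfold particleField
        by_cases hs : s ∈ {s | (s, u s) ∈ Icc 0 T ×ˢ U}
        · rw [indicator_of_mem hs]
          exact (hC s hs.1 _ hs.2 _ _).2
        · rw [indicator_of_notMem hs]
          simpa using hC0.le)
    rw [sub_zero, abs_of_nonneg ht.1] at h2
    exact h2.trans (by rw [hcdef]; gcongr; exact ht.2)
  have hSeq : ∀ t ∈ Icc 0 T, ∀ x ∈ K, S t x = (x + (Z (t, x)).1, Real.exp (Z (t, x)).2) := by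
    intro t ht x hx
    have h1 : x + (Z (t, x)).1 ∈ cube n R := mem_cube_of_norm_le <| (norm_add_le _ _).trans
      (add_le_add (hR₀ x hx) ((norm_fst_le _).trans (hZ1 t ht x)))
    simp only [hS, particle, slice_apply, cubeProj_eq h1, clamp_eq (abs_le.1 (hZ2 t ht x))]
  have hmS : Measurable fun p : Rn n × ℝ => S p.2 p.1 := by
    have : Continuous fun p : Rn n × ℝ => S p.2 p.1 := by
      simp only [hS, particle, slice_apply]
      fun_prop
    exact this.measurable
  have hLDT : ∀ x, ∀ᵐ t ∂(volume.restrict (Icc 0 T)),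
      HasDerivAt (fun t => Z (t, x)) (B (slice Z t) t x) t := by
    intro x
    have h1 := (hB.intervalIntegrable Z x 0 T).ae_hasDerivAt_integral
    rw [uIcc_of_le hT.le] at h1
    rw [ae_restrict_iff' measurableSet_Icc]
    have h0 : ∀ᵐ t : ℝ, t ≠ 0 := by simp [ae_iff, measure_singleton]
    have hT' : ∀ᵐ t : ℝ, t ≠ T := by simp [ae_iff, measure_singleton]
    filter_upwards [h1, h0, hT'] with t ht ht0 htT htm
    have htm' : t ∈ Ioo 0 T :=
      ⟨lt_of_le_of_ne htm.1 (Ne.symm ht0), lt_of_le_of_ne htm.2 htT⟩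
    refine (ht htm 0 (left_mem_Icc.2 hT.le)).congr_of_eventuallyEq ?_
    filter_upwards [Ioo_mem_nhds htm'.1 htm'.2] with r hr
    exact hZ r (Ioo_subset_Icc_self hr) x
  -- the integral form of the equation
  have main : ∀ φ : Rn n × ℝ → ℝ, ContDiff ℝ 1 φ → ∃ D : ℝ, 0 ≤ D ∧ ∃ e : ℝ → ℝ,
      Measurable e ∧ (∀ s, |e s| ≤ D) ∧
      (∀ᵐ s ∂(volume.restrict (Icc 0 T)), e s
        = ∫ z, fderiv ℝ φ z (liftedField F G s (u s) (ρ s) z) ∂(ρ s).1) ∧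
      ∀ t ∈ Icc 0 T, ∫ z, φ z ∂(ρ t).1 = ∫ z, φ z ∂(ρ 0).1 + ∫ s in (0 : ℝ)..t, e s := by
    intro φ hφ
    have hφ' := hφ.continuous_fderiv one_ne_zero
    set d : Rn n → ℝ → ℝ := fun x s => fderiv ℝ φ (S s x)
      ((B (slice Z s) s x).1, (S s x).2 * (B (slice Z s) s x).2) with hd
    have hBm := hB.measurable_uncurry Z
    have hdm : Measurable fun p : Rn n × ℝ => d p.1 p.2 := by
      have h1 : Measurable fun p : Rn n × ℝ => fderiv ℝ φ (S p.2 p.1) :=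
        hφ'.measurable.comp hmS
      have h2 : Measurable fun p : Rn n × ℝ => ((B (slice Z p.2) p.2 p.1).1,
          (S p.2 p.1).2 * (B (slice Z p.2) p.2 p.1).2) :=
        hBm.fst.prodMk (hmS.snd.mul hBm.snd)
      have h3 : Continuous fun q : ((Rn n × ℝ) →L[ℝ] ℝ) × (Rn n × ℝ) => q.1 q.2 := by fun_prop
      exact h3.measurable.comp (h1.prodMk h2)
    obtain ⟨D₁, hD₁⟩ := (((isCompact_cube n R).prod (isCompact_Icc (a := 0)
      (b := Real.exp c))).image hφ').isBounded.exists_norm_le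
    have hD₁' : ∀ s x, ‖fderiv ℝ φ (S s x)‖ ≤ max D₁ 0 := fun s x =>
      (hD₁ _ (mem_image_of_mem _ (particle_mem hR hc _ x))).trans (le_max_left _ _)
    set D := max D₁ 0 * (V + Real.exp c * V) with hDdef
    have hD0 : 0 ≤ D := by positivity
    have hdD : ∀ x s, ‖d x s‖ ≤ D := by
      intro x s
      refine (ContinuousLinearMap.le_of_opNorm_le _ (hD₁' s x) _).trans ?_
      have h1 : ‖(B (slice Z s) s x).1‖ ≤ V := (norm_fst_le _).trans (hBV s x)
      have h2 : ‖(B (slice Z s) s x).2‖ ≤ V := (norm_snd_le _).trans (hBV s x)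
      rw [hDdef]
      gcongr
      rw [Prod.norm_def]
      have h3 : 0 ≤ Real.exp c * V := by positivity
      refine max_le (by simp only; linarith) ?_
      simp only [norm_mul, Real.norm_eq_abs]
      have h4 : |(S s x).2| ≤ Real.exp c := by
        have h5 : 0 < (S s x).2 := Real.exp_pos _
        rw [abs_of_pos h5]
        exact particle_snd_le hc _ x
      have := mul_le_mul h4 h2 (norm_nonneg _) (Real.exp_pos c).le
      rw [Real.norm_eq_abs] at this
      linarith
    -- the fundamental theorem of calculus along each characteristic
    have hFTC : ∀ x ∈ K, ∀ t ∈ Icc 0 T, φ (S t x) = φ (S 0 x) + ∫ s in (0 : ℝ)..t, d x s := by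
      intro x hx t ht
      set Q : Rn n × ℝ → ℝ := fun w => φ (x + w.1, Real.exp w.2) with hQ
      have hQc : ContDiff ℝ 1 Q := by
        refine hφ.comp ?_
        exact (contDiff_const.add contDiff_fst).prodMk contDiff_snd.exp
      have hSQ : ∀ s ∈ Icc 0 T, φ (S s x) = Q (Z (s, x)) := fun s hs => by
        rw [hSeq s hs x hx]
      obtain ⟨κ, hκ⟩ := hQc.contDiffOn.exists_lipschitzOnWith (s := closedBall 0 (V * T))
        one_ne_zero (convex_closedBall _ _) (isCompact_closedBall _ _)
      have hZlip : LipschitzOnWith V.toNNReal (fun s => Z (s, x)) (Icc 0 T) := by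
        refine LipschitzOnWith.of_dist_le_mul fun s hs r hr => ?_
        rw [dist_eq_norm, hZ s hs, hZ r hr, intervalIntegral.integral_interval_sub_left
          (hB.intervalIntegrable _ _ _ _) (hB.intervalIntegrable _ _ _ _),
          Real.coe_toNNReal _ hV0, Real.dist_eq]
        exact intervalIntegral.norm_integral_le_of_norm_le_const fun y _ => hBV y x
      have hac : AbsolutelyContinuousOnInterval (fun s => Q (Z (s, x))) 0 t := by
        refine LipschitzOnWith.absolutelyContinuousOnInterval (K := κ * V.toNNReal) ?_
        rw [uIcc_of_le ht.1]
        refine (hκ.comp hZlip fun s hs => ?_).mono (Icc_subset_Icc_right ht.2)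
        rw [mem_closedBall_zero_iff]
        exact hZ1 s hs x
      have h1 := hac.integral_deriv_eq_sub
      rw [hSQ t ht, hSQ 0 (left_mem_Icc.2 hT.le)]
      have h2 : ∫ s in (0 : ℝ)..t, d x s = ∫ s in (0 : ℝ)..t, deriv (fun s => Q (Z (s, x))) s := by
        refine intervalIntegral.integral_congr_ae ?_
        have h3 := hLDT x
        rw [ae_restrict_iff' measurableSet_Icc] at h3
        filter_upwards [h3] with s hs hst
        rw [uIoc_of_le ht.1] at hst
        have hsm : s ∈ Icc 0 T := ⟨hst.1.le, hst.2.trans ht.2⟩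
        have h4 := hs hsm
        have h5 : HasDerivAt (fun s => (x + (Z (s, x)).1, Real.exp (Z (s, x)).2))
            ((B (slice Z s) s x).1, Real.exp (Z (s, x)).2 * (B (slice Z s) s x).2) s := by
          have h6 : HasDerivAt (fun s => (Z (s, x)).1) (B (slice Z s) s x).1 s :=
            (hasFDerivAt_fst (𝕜 := ℝ) (E := Rn n) (F := ℝ)).comp_hasDerivAt s h4
          have h7 : HasDerivAt (fun s => (Z (s, x)).2) (B (slice Z s) s x).2 s :=
            (hasFDerivAt_snd (𝕜 := ℝ) (E := Rn n) (F := ℝ)).comp_hasDerivAt s h4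
          exact (h6.const_add x).prodMk h7.exp
        have h8 := ((hφ.differentiable one_ne_zero
          (x + (Z (s, x)).1, Real.exp (Z (s, x)).2)).hasFDerivAt).comp_hasDerivAt s h5
        have h9 : deriv (fun s => Q (Z (s, x))) s = _ := h8.deriv
        rw [h9, hd]
        simp only [hSeq s hsm x hx]
      rw [h2, h1]
      ring
    have hdint : ∀ t, Integrable (Function.uncurry fun (s : ℝ) (x : Rn n) => d x s)
        ((volume.restrict (uIoc 0 t)).prod ϑ.1) := fun t => by
      have : IsFiniteMeasure (volume.restrict (uIoc (0 : ℝ) t)) := ⟨by simp [uIoc]⟩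
      exact Integrable.of_bound (hdm.comp measurable_swap).aestronglyMeasurable D
        (Eventually.of_forall fun p => hdD p.2 p.1)
    refine ⟨D, hD0, fun s => ∫ x, d x s ∂ϑ.1, ?_, fun s => ?_, ?_, ?_⟩
    · exact (StronglyMeasurable.integral_prod_right (ν := ϑ.1)
        (f := fun (s : ℝ) (x : Rn n) => d x s)
        (hdm.comp measurable_swap).stronglyMeasurable).measurable
    · have := abs_integral_le_mul_real (μ := ϑ.1) (m := 1) hD0 (fun x => hdD x s) (by simp)
      rwa [mul_one] at this
    · filter_upwards [hu, ae_restrict_mem measurableSet_Icc] with s hus hs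
      obtain ⟨hF, hG⟩ := hFG.continuous_space hs hus (bary (ρ s))
      rw [hρ]
      rw [integral_particleLaw ϑ hϑ hR hc (slice Z s) (by unfold liftedField; fun_prop)]
      congr 1
      ext x
      have hs' : s ∈ {s | (s, u s) ∈ Icc 0 T ×ˢ U} := ⟨hs, hus⟩
      simp only [hd, hBdef, particleField, indicator_of_mem hs']
      rfl
    · intro t ht
      have h1 := hφ.continuous
      rw [hρ]
      simp only
      rw [integral_particleLaw ϑ hϑ hR hc (slice Z t) h1,
        integral_particleLaw ϑ hϑ hR hc (slice Z 0) h1,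
        intervalIntegral_integral_swap (hdint t)]
      have h2 : Integrable (fun x => ∫ s in (0 : ℝ)..t, d x s) ϑ.1 := by
        simp_rw [intervalIntegral.integral_of_le ht.1]
        have := (hdint t).integral_prod_right
        rw [uIoc_of_le ht.1] at this
        exact this
      rw [← integral_add (f := fun x => φ (particle R c (slice Z 0) x))
        (ϑ.integrable (h1.comp (continuous_particle R c (slice Z 0)))) h2]
      refine integral_congr_ae ?_
      filter_upwards [hϑK'] with x hx using hFTC x hx t ht
  refine ⟨ρ, ?_, fun φ hφ => ?_, fun φ hφ => ?_⟩
  · change ϑ.1.map (particle R c (slice Z 0)) = _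
    rw [Measure.prod_dirac]
    refine Measure.map_congr ?_
    filter_upwards [hϑK'] with x hx
    have h0 : (0 : ℝ) ∈ Icc 0 T := left_mem_Icc.2 hT.le
    have h1 := hSeq 0 h0 x hx
    rw [hZ 0 h0, intervalIntegral.integral_same] at h1
    simpa using h1
  · obtain ⟨D, hD0, e, hem, heD, -, he⟩ := main φ hφ
    have hei : ∀ a b, IntervalIntegrable e volume a b := fun a b =>
      (intervalIntegrable_const (c := D)).mono_fun hem.aestronglyMeasurable
        (Eventually.of_forall fun s => (heD s).trans (le_abs_self D))
    refine LipschitzOnWith.absolutelyContinuousOnInterval (K := D.toNNReal) ?_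
    rw [uIcc_of_le hT.le]
    refine LipschitzOnWith.of_dist_le_mul fun s hs r hr => ?_
    rw [he s hs, he r hr, dist_add_left, dist_eq_norm,
      intervalIntegral.integral_interval_sub_left (hei _ _) (hei _ _),
      Real.coe_toNNReal _ hD0, Real.dist_eq]
    exact intervalIntegral.norm_integral_le_of_norm_le_const fun y _ => heD y
  · obtain ⟨D, hD0, e, hem, heD, hee, he⟩ := main φ hφ
    have hei : IntervalIntegrable e volume 0 T :=
      (intervalIntegrable_const (c := D)).mono_fun hem.aestronglyMeasurable
        (Eventually.of_forall fun s => (heD s).trans (le_abs_self D))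
    have h1 := hei.ae_hasDerivAt_integral
    rw [uIcc_of_le hT.le] at h1
    rw [ae_restrict_iff' measurableSet_Icc] at hee ⊢
    have h0 : ∀ᵐ t : ℝ, t ≠ 0 := by simp [ae_iff, measure_singleton]
    have hT' : ∀ᵐ t : ℝ, t ≠ T := by simp [ae_iff, measure_singleton]
    filter_upwards [h1, h0, hT', hee] with t ht ht0 htT htee htm
    have htm' : t ∈ Ioo 0 T :=
      ⟨lt_of_le_of_ne htm.1 (Ne.symm ht0), lt_of_le_of_ne htm.2 htT⟩
    rw [← htee htm]
    refine ((ht htm 0 (left_mem_Icc.2 hT.le)).const_add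
      (∫ z, φ z ∂(ρ 0).1)).congr_of_eventuallyEq ?_
    filter_upwards [Ioo_mem_nhds htm'.1 htm'.2] with r hr
    exact he r (Ioo_subset_Icc_self hr)

end

end BalanceLaw

theorem mainTheorem3 {m n : ℕ} (T : ℝ) (hT : 0 < T) (U : Set (Rn m)) (hU : IsCompact U)
    (F : NonlocalField m n) (G : NonlocalDensity m n) (hFG : RegularData T U F G)
    (ϑ : StateSpace n) (hϑ : IsProbabilityMeasure ϑ.1) (ℓ : StateSpace n → ℝ) :
    (∀ u ∈ Controls T U,
      (∃ μ, SolvesBalance T F G ϑ u μ ∧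
        ∀ μ', SolvesBalance T F G ϑ u μ' → EqOn μ' μ (Icc 0 T)) ∧
      (∃ ρ, SolvesLifted T F G ϑ u ρ ∧
        ∀ ρ', SolvesLifted T F G ϑ u ρ' → EqOn ρ' ρ (Icc 0 T)) ∧
      (∀ μ ρ, SolvesBalance T F G ϑ u μ → SolvesLifted T F G ϑ u ρ →
        ∀ t ∈ Icc 0 T, μ t = bary (ρ t))) ∧
    (∀ u, IsOptimal T U F G ϑ ℓ u ↔ IsOptimalLifted T U F G ϑ ℓ u) := by
  have hex : ∀ u ∈ Controls T U, ∃ ρ, SolvesLifted T F G ϑ u ρ := fun u hu =>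
    exists_solvesLifted hT hU hFG ϑ hϑ (Lp.stronglyMeasurable u).measurable hu
  have hbary : ∀ u ∈ Controls T U, ∀ μ ρ, SolvesBalance T F G ϑ u μ → SolvesLifted T F G ϑ u ρ →
      ∀ t ∈ Icc 0 T, μ t = bary (ρ t) := fun u hu μ ρ hμ hρ t ht =>
    hμ.eqOn hFG hϑ hu (hρ.solvesBalance hFG hu) ht
  have hTm : T ∈ Icc 0 T := right_mem_Icc.2 hT.le
  refine ⟨fun u hu => ⟨?_, ?_, hbary u hu⟩, fun u => ⟨?_, ?_⟩⟩
  · obtain ⟨ρ, hρ⟩ := hex u hu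
    exact ⟨_, hρ.solvesBalance hFG hu, fun μ' hμ' =>
      hμ'.eqOn hFG hϑ hu (hρ.solvesBalance hFG hu)⟩
  · obtain ⟨ρ, hρ⟩ := hex u hu
    exact ⟨ρ, hρ, fun ρ' hρ' => hρ'.eqOn hFG hϑ hu hρ⟩
  · rintro ⟨hu, μ, hμ, hopt⟩
    obtain ⟨ρ, hρ⟩ := hex u hu
    refine ⟨hu, ρ, hρ, fun v hv σ hσ => ?_⟩
    rw [← hbary u hu μ ρ hμ hρ T hTm]
    exact hopt v hv _ (hσ.solvesBalance hFG hv)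
  · rintro ⟨hu, ρ, hρ, hopt⟩
    refine ⟨hu, _, hρ.solvesBalance hFG hu, fun v hv ν hν => ?_⟩
    obtain ⟨σ, hσ⟩ := hex v hv
    rw [hbary v hv ν σ hν hσ T hTm]
    exact hopt v hv σ hσ
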